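/- Throughout, a temporal graph $\mathcal G=(G_1,\dots,G_\ell)$ with lifetime $\ell$ is a sequence of simple undirected graphs on one finite vertex set $V$, $n=|V|$; it is connected if every $G_t$ is connected. $\mathrm{Aut}(\mathcal G)$ is the group of all permutations of $V$ that are automorphisms of every $G_t$; its orbits on $V$ are the orbits of $\mathcal G$, and their number $r$ is the orbit number. A temporal walk occupies a vertex at the beginning of each time step $1,\dots,\ell$, and between time steps $t$ and $t+1$ it either waits or traverses an edge of $G_t$. A program is an algorithm (a computable function) whose input is a temporal graph with vertex labels $0,\dots,n-1$, given by the list of the adjacency matrices of its snapshots, together with the label of a start vertex, and whose output is the list of the labels of the vertices to be occupied in time steps $1,\dots,\ell$. An agent runs its program on $\mathcal G$ and its own start vertex, as seen under its own bijective labelling $V\to\{0,\dots,n-1\}$; it receives no other information. **Theorem.** For every fixed $\epsilon>0$ there are deterministic programs $p_1,p_2$, a rule $S$ that assigns to every finite nonempty temporal graph $\mathcal G$ an orbit $S(\mathcal G)$ of smallest size and is canonical (for every temporal isomorphism $\theta:\mathcal G\to\mathcal H$, i.e. a bijection of the vertex sets that is an isomorphism $G_t\to H_t$ for every $t$, one has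 $\theta(S(\mathcal G))=S(\mathcal H)$), and a constant $C$ depending only on $\epsilon$ such that the following holds for every connected temporal graph $\mathcal G$ with $n$ vertices, orbit number $r$ and lifetime $\ell\ge n^2$, all start vertices $x_1,x_2\in V$ and all labellings $\lambda_1,\lambda_2:V\to\{0,\dots,n-1\}$ of the two agents (all chosen after the programs): $|S(\mathcal G)|\le n/r$; the programs $p_1$ and $p_2$, run by agent $1$ from $x_1$ under $\lambda_1$ and by agent $2$ from $x_2$ under $\lambda_2$, output temporal walks $W_1$ and $W_2$ of $\mathcal G$ that start at $x_1$ and $x_2$; in some time step $t\le C\,n^{1+\epsilon}$ both walks are at the same vertex, and this vertex lies in $S(\mathcal G)$; and $W_2$ visits every vertex of $S(\mathcal G)$ within the first $C\,n^{1+\epsilon}$ time steps. -/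

import Mathlib

universe u v

/-- A temporal graph with vertex set `V` and lifetime `ℓ`: a sequence of `ℓ` simple undirected
graphs on `V`. The index `t : Fin ℓ` stands for the time step `t + 1`. -/
structure TemporalGraph (V : Type u) (ℓ : ℕ) where
  snapshot : Fin ℓ → SimpleGraph V

namespace TemporalGraph

variable {V : Type u} {W : Type v} {ℓ : ℕ}

/-- Every snapshot is connected. -/
def Connected (G : TemporalGraph V ℓ) : Prop :=
  ∀ t, (G.snapshot t).Connected

/-- The bijection `θ` is a temporal isomorphism from `G` to `H`. -/
def IsIso (G : TemporalGraph V ℓ) (H : TemporalGraph W ℓ) (θ : V ≃ W) : Prop :=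
  ∀ t x y, (H.snapshot t).Adj (θ x) (θ y) ↔ (G.snapshot t).Adj x y

/-- The automorphism group of a temporal graph. -/
def aut (G : TemporalGraph V ℓ) : Subgroup (Equiv.Perm V) where
  carrier := {σ | G.IsIso G σ}
  mul_mem' {a b} ha hb t x y := (ha t (b x) (b y)).trans (hb t x y)
  one_mem' _ _ _ := Iff.rfl
  inv_mem' {a} ha t x y := by
    have h := ha t (a⁻¹ x) (a⁻¹ y)
    simpa using h.symm

/-- The set of orbits of the automorphism group. -/
def orbits (G : TemporalGraph V ℓ) : Set (Set V) :=
  Set.range fun x : V => MulAction.orbit G.aut x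

/-- The orbit number. -/
noncomputable def orbitNumber (G : TemporalGraph V ℓ) : ℕ :=
  G.orbits.ncard

/-- The temporal graph `G` as it looks once every vertex `x` has been renamed `lab x`. -/
def relabel (G : TemporalGraph V ℓ) (lab : V ≃ W) : TemporalGraph W ℓ where
  snapshot t := (G.snapshot t).comap lab.symm

open Classical in
/-- The full description of a temporal graph with vertices `0, …, n - 1`: the list of the
adjacency matrices of its snapshots, in the order of the time steps. -/
noncomputable def matrices {n : ℕ} (G : TemporalGraph (Fin n) ℓ) : List (List (List Bool)) :=
  List.ofFn fun t => List.ofFn fun i => List.ofFn fun j => decide ((G.snapshot t).Adj i j)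

end TemporalGraph

/-- A temporal walk that lasts for the whole lifetime: `pos t` is the vertex occupied at the
beginning of the time step with index `t`, and from one time step to the next the walk either
waits or traverses an edge that is present in the current snapshot. -/
structure TemporalWalk {V : Type u} {ℓ : ℕ} (G : TemporalGraph V ℓ) where
  pos : Fin ℓ → V
  step : ∀ s t : Fin ℓ, (t : ℕ) = s + 1 → pos t = pos s ∨ (G.snapshot s).Adj (pos s) (pos t)

/-- The walk starts at `x` in the first time step. -/
def TemporalWalk.StartsAt {V : Type u} {ℓ : ℕ} {G : TemporalGraph V ℓ} (W : TemporalWalk G)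
    (x : V) : Prop :=
  ∀ t : Fin ℓ, (t : ℕ) = 0 → W.pos t = x

/-- A deterministic program of an agent: an algorithm that receives the adjacency matrices of a
temporal graph and the label of the start vertex, and outputs the list of the labels of the
vertices at which the agent is to be in the successive time steps. -/
structure Program where
  run : List (List (List Bool)) × ℕ → List ℕ
  computable : Computable run

/-- An agent that runs `p`, starts at `x`, and sees every vertex `y` of `G` under the label `lab y`
(its whole input is the temporal graph in these labels, and the label of `x`) performs the temporal
walk `W`, which starts at `x`. -/
def Program.Performs {V : Type u} {n ℓ : ℕ} (p : Program) (G : TemporalGraph V ℓ)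
    (lab : V ≃ Fin n) (x : V) (W : TemporalWalk G) : Prop :=
  W.StartsAt x ∧
    p.run ((G.relabel lab).matrices, (lab x : ℕ)) = List.ofFn fun t => (lab (W.pos t) : ℕ)

/-- `S` selects in every finite nonempty temporal graph an orbit of smallest size, and it does so
canonically: the selection is preserved by all temporal isomorphisms, so that it does not depend on
vertex labels. -/
structure IsCanonicalSmallestOrbit
    (S : ∀ (V : Type u) (ℓ : ℕ), TemporalGraph V ℓ → Set V) : Prop where
  mem_orbits : ∀ (V : Type u) [Finite V] [Nonempty V] (ℓ : ℕ) (G : TemporalGraph V ℓ),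
    S V ℓ G ∈ G.orbits
  ncard_le : ∀ (V : Type u) [Finite V] [Nonempty V] (ℓ : ℕ) (G : TemporalGraph V ℓ),
    ∀ T ∈ G.orbits, (S V ℓ G).ncard ≤ T.ncard
  image_eq : ∀ (V V' : Type u) [Finite V] [Nonempty V] (ℓ : ℕ) (G : TemporalGraph V ℓ)
    (H : TemporalGraph V' ℓ) (θ : V ≃ V'), G.IsIso H θ → θ '' S V ℓ G = S V' ℓ H

/-!
Agent 1 walks to some vertex of a canonical orbit `S` of smallest size and stays there; this takes
at most `n - 1` steps. Agent 2 visits all vertices of `S` at times from `n - 1` on, so it finds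
agent 1. What has to be shown is that `S` can be explored in `O(n ^ (1 + ε))` steps, and that both
agents can compute their walks.

**Exploration.** Let `s = |S|` and let `r` be the number of orbits, so that `r * s ≤ n`. The set of
vertices that can be reached from a given vertex gains a vertex in every step, and every vertex can
reach `S` in `r - 1` steps, as the set of orbits that can be reached gains an orbit in every step.
Averaging over the automorphism group shows that going to `S` does not decrease the relative size
of a set (`card_mul_le_card_biUnion_mul`); therefore at least `m` vertices of `S` can be reached in
`O(n * m / s)` steps (`le_card_reach_orbit`).

Suppose now that some walk visits `k` vertices of `S` in `T` steps. By symmetry there is such a walk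
from every vertex of `S`. A walk that has visited `A ⊆ S` is continued by travelling until `m`
vertices of `S` are in reach, and then following a translate of the given walk that starts at one
of them. By averaging, a translate can be chosen that revisits at most `k * |A| / m` vertices
(`Explores.exists_extension`). With `m = 2 * b * k` and `2 * b` rounds, this multiplies `k` by `b`
and the time by `2 * b`, apart from the time for travelling (`Explores.mul`). Taking `b = 2 ^ p`,
one arrives at a number of visited vertices `k` with `s / (2 * b) < k ≤ s` in time
`O(n * 2 ^ j)` where `2 ^ j = k ^ (1 / p)`. From there on, rounds with `m = s` shrink the unvisited
part of `S` by a constant factor each, so that `O(log s)` rounds visit all of it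
(`exists_fast_tour`). If this takes longer than the lifetime, visiting the vertices one by one is
even faster (`exists_slow_tour`).

**Computation.** The orbit `S` consists of the vertices which, among those with an orbit of smallest
size, attain the smallest encoding of the relabelled temporal graph together with the label of the
vertex, over all labellings (`TemporalGraph.leastOrbit`). Membership in `S` and the walks of the
agents are found by searches through all permutations and all walks, which are primitive
recursive. Agent 2 takes a walk that completes its tour as early as possible, so its program does
not even depend on `ε`.
-/

/-! ### Walks in an infinite sequence of graphs -/

namespace Exploration

open MulAction

section Walks

variable {V : Type*} {G : ℕ → SimpleGraph V}

/-- A walk of infinite duration in a sequence of graphs: `f t` is the vertex occupied at time `t`,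
and the `t`-th step waits or uses an edge of `G t`. -/
def IsWalk (G : ℕ → SimpleGraph V) (f : ℕ → V) : Prop :=
  ∀ t, f (t + 1) = f t ∨ (G t).Adj (f t) (f (t + 1))

theorem isWalk_const (x : V) : IsWalk G fun _ => x := fun _ => Or.inl rfl

/-- A walk may be left after time `t` for another one whose position at time `t + 1` can be reached
in one step. -/
theorem IsWalk.switch {f g : ℕ → V} (hf : IsWalk G f) (hg : IsWalk G g) {t : ℕ}
    (h : g (t + 1) = f t ∨ (G t).Adj (f t) (g (t + 1))) :
    IsWalk G fun s => if s ≤ t then f s else g s := by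
  intro s
  rcases lt_trichotomy s t with hs | rfl | hs
  · have h1 : s + 1 ≤ t := hs
    simpa [hs.le, h1] using hf s
  · simpa using h
  · have h1 : ¬ s ≤ t := by omega
    have h2 : ¬ s + 1 ≤ t := by omega
    simpa [h1, h2] using hg s

theorem IsWalk.exists_concat {f g : ℕ → V} (hf : IsWalk G f) (hg : IsWalk G g) {t : ℕ}
    (h : f t = g t) :
    ∃ p, IsWalk G p ∧ (∀ s ≤ t, p s = f s) ∧ ∀ s, t ≤ s → p s = g s := by
  refine ⟨_, hf.switch hg (t := t) (by rw [h]; exact hg t), fun s hs => by simp [hs],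
    fun s hs => ?_⟩
  rcases hs.eq_or_lt with rfl | hs
  · simpa using h
  · simp [not_le.2 hs]

/-- The vertices that can be reached within `d` steps from `x`, starting at time `t`. -/
def reach (G : ℕ → SimpleGraph V) (t : ℕ) (x : V) (d : ℕ) : Set V :=
  {y | ∃ f, IsWalk G f ∧ f t = x ∧ f (t + d) = y}

theorem mem_reach_self (t : ℕ) (x : V) (d : ℕ) : x ∈ reach G t x d :=
  ⟨_, isWalk_const x, rfl, rfl⟩

theorem mem_reach_succ {t d : ℕ} {x y z : V} (h : y ∈ reach G t x d)
    (hz : z = y ∨ (G (t + d)).Adj y z) : z ∈ reach G t x (d + 1) := by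
  obtain ⟨f, hf, h1, rfl⟩ := h
  refine ⟨_, hf.switch (isWalk_const z) (t := t + d) hz, by simpa using h1, ?_⟩
  have : ¬ t + (d + 1) ≤ t + d := by omega
  simp [this]

theorem reach_trans {t d e : ℕ} {x y z : V} (h : y ∈ reach G t x d)
    (h' : z ∈ reach G (t + d) y e) : z ∈ reach G t x (d + e) := by
  obtain ⟨f, hf, h1, h2⟩ := h
  obtain ⟨g, hg, h3, h4⟩ := h'
  obtain ⟨p, hp, h5, h6⟩ := hf.exists_concat hg (t := t + d) (by rw [h2, h3])
  exact ⟨p, hp, by rw [h5 _ (by omega), h1], by rw [h6 _ (by omega), ← add_assoc, h4]⟩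

theorem reach_mono {t d e : ℕ} (h : d ≤ e) (x : V) : reach G t x d ⊆ reach G t x e := by
  intro y hy
  obtain ⟨k, rfl⟩ := Nat.exists_eq_add_of_le h
  exact reach_trans hy (mem_reach_self _ _ _)

theorem exists_adj_boundary {H : SimpleGraph V} (hH : H.Connected) {C : Set V} {x y : V}
    (hx : x ∈ C) (hy : y ∉ C) : ∃ a ∈ C, ∃ b ∉ C, H.Adj a b := by
  obtain ⟨p⟩ := hH.preconnected x y
  obtain ⟨d, -, h1, h2⟩ := p.exists_boundary_dart C hx hy
  exact ⟨_, h1, _, h2, d.adj⟩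

theorem min_le_ncard_of_growing {α : Type*} [Finite α] {X : ℕ → Set α} {U : Set α}
    (h0 : (X 0).Nonempty) (hX : ∀ j, X j ≠ U → X j ⊂ X (j + 1)) (hm : ∀ j, X j ⊆ X (j + 1))
    (j : ℕ) : min (j + 1) U.ncard ≤ (X j).ncard := by
  induction j with
  | zero => exact (min_le_left _ _).trans ((Set.ncard_pos).2 h0)
  | succ j ih =>
    by_cases h : X j = U
    · exact (min_le_right _ _).trans (h ▸ Set.ncard_le_ncard (hm j))
    · have := Set.ncard_lt_ncard (hX j h)
      omega

theorem min_le_ncard_reach [Finite V] (hG : ∀ t, (G t).Connected) (t : ℕ) (x : V) (d : ℕ) :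
    min (d + 1) (Nat.card V) ≤ (reach G t x d).ncard := by
  rw [← Set.ncard_univ]
  refine min_le_ncard_of_growing ⟨x, mem_reach_self _ _ _⟩ (fun j hj => ?_)
    (fun j => reach_mono j.le_succ x) d
  obtain ⟨y, hy⟩ := (Set.ne_univ_iff_exists_notMem _).1 hj
  obtain ⟨a, ha, b, hb, hab⟩ := exists_adj_boundary (hG (t + j)) (mem_reach_self t x j) hy
  exact Set.ssubset_iff_exists.2
    ⟨reach_mono j.le_succ x, b, mem_reach_succ ha (Or.inr hab), hb⟩

theorem mem_reach_of_card_le [Finite V] (hG : ∀ t, (G t).Connected) (t : ℕ) (x y : V) {d : ℕ}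
    (hd : Nat.card V ≤ d + 1) : y ∈ reach G t x d := by
  have h := min_le_ncard_reach hG t x d
  rw [min_eq_right hd, ← Set.ncard_univ] at h
  rw [Set.eq_of_subset_of_ncard_le (Set.subset_univ _) h]
  trivial

end Walks

/-! ### Walks and symmetry -/

section Symmetry

variable {V : Type*} {G : ℕ → SimpleGraph V} {Γ : Type*} [Group Γ] [MulAction Γ V]

/-- The group `Γ` acts by automorphisms of every graph of the sequence. -/
def Preserves (Γ : Type*) [Group Γ] [MulAction Γ V] (G : ℕ → SimpleGraph V) : Prop :=
  ∀ (g : Γ) t x y, (G t).Adj x y → (G t).Adj (g • x) (g • y)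

theorem IsWalk.smul (hΓ : Preserves Γ G) {f : ℕ → V} (hf : IsWalk G f) (g : Γ) :
    IsWalk G fun t => g • f t := by
  intro t
  rcases hf t with h | h
  · exact Or.inl (by simp only [h])
  · exact Or.inr (hΓ g t _ _ h)

theorem smul_mem_reach (hΓ : Preserves Γ G) (g : Γ) {t d : ℕ} {x y : V}
    (h : y ∈ reach G t x d) : g • y ∈ reach G t (g • x) d := by
  obtain ⟨f, hf, h1, h2⟩ := h
  exact ⟨_, hf.smul hΓ g, by simp only [h1], by simp only [h2]⟩

/-- Every orbit can be reached from everywhere in fewer steps than there are orbits: the set of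
orbits met by the reachable vertices grows in every step, because an edge that leaves the union of
these orbits has a translate that starts at a reachable vertex. -/
theorem exists_mem_orbit_reach [Finite V] (hG : ∀ t, (G t).Connected) (hΓ : Preserves Γ G)
    (t : ℕ) (w v : V) {d : ℕ} (hd : (Set.range fun x : V => orbit Γ x).ncard ≤ d + 1) :
    ∃ y ∈ orbit Γ v, y ∈ reach G t w d := by
  have hm : ∀ j, (fun x => orbit Γ x) '' reach G t w j ⊆
      (fun x => orbit Γ x) '' reach G t w (j + 1) :=
    fun j => Set.image_mono (reach_mono j.le_succ w)
  have key := min_le_ncard_of_growing (X := fun j => (fun x => orbit Γ x) '' reach G t w j)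
    (U := Set.range fun x : V => orbit Γ x) ⟨_, w, mem_reach_self _ _ _, rfl⟩ (fun j hj => ?_) hm d
  · rw [min_eq_right hd] at key
    have h := Set.eq_of_subset_of_ncard_le (Set.image_subset_range _ _) key
    obtain ⟨y, hy, hyv⟩ : orbit Γ v ∈ (fun x => orbit Γ x) '' reach G t w d := by
      rw [h]; exact ⟨v, rfl⟩
    exact ⟨y, orbit_eq_iff.1 hyv, hy⟩
  · obtain ⟨y, hy⟩ : ∃ y, orbit Γ y ∉ (fun x => orbit Γ x) '' reach G t w j := by
      by_contra! h
      exact hj (subset_antisymm (Set.image_subset_range _ _) (by rintro _ ⟨y, rfl⟩; exact h y))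
    obtain ⟨a, ⟨a', ha', haa⟩, b, hb, hab⟩ := exists_adj_boundary (hG (t + j))
      (C := {z | orbit Γ z ∈ (fun x => orbit Γ x) '' reach G t w j}) (x := w) (y := y)
      ⟨w, mem_reach_self _ _ _, rfl⟩ hy
    obtain ⟨g, rfl⟩ := orbit_eq_iff.1 haa
    refine Set.ssubset_iff_exists.2 ⟨hm j, orbit Γ b, ⟨g • b, ?_, ?_⟩, hb⟩
    · exact mem_reach_succ ha' (Or.inr (hΓ g _ _ _ hab))
    · exact orbit_eq_iff.2 ⟨g, rfl⟩

end Symmetry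

/-! ### Averaging over a group -/

section Averaging

open Finset

variable {V : Type*} [DecidableEq V] {Γ : Type*} [Group Γ] [Fintype Γ] [MulAction Γ V]
  {S : Finset V} {v₀ : V}

/-- In a transitive action, the number of group elements that take `y` to `a` does not depend on
`y` and `a`. -/
theorem exists_card_transporter (hS : (S : Set V) = orbit Γ v₀) :
    ∃ c, 0 < c ∧ ∀ y ∈ S, ∀ a ∈ S, #{g : Γ | g • y = a} = c := by
  refine ⟨#{g : Γ | g • v₀ = v₀}, card_pos.2 ⟨1, by simp⟩, fun y hy a ha => ?_⟩
  rw [← mem_coe, hS] at hy ha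
  obtain ⟨h, rfl⟩ := hy
  obtain ⟨k, rfl⟩ := ha
  refine card_bij' (fun g _ => k⁻¹ * g * h) (fun g _ => k * g * h⁻¹) ?_ ?_ ?_ ?_
  · intro g hg
    simp only [mem_filter_univ] at hg ⊢
    rw [mul_smul, mul_smul, hg, inv_smul_smul]
  · intro g hg
    simp only [mem_filter_univ] at hg ⊢
    rw [mul_smul, mul_smul, inv_smul_smul, hg]
  · intro g _; group
  · intro g _; group

theorem card_eq_mul_of_transporter {c : ℕ} (hS : (S : Set V) = orbit Γ v₀)
    (hc : ∀ y ∈ S, ∀ a ∈ S, #{g : Γ | g • y = a} = c) : Fintype.card Γ = #S * c := by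
  have h0 : v₀ ∈ S := by rw [← mem_coe, hS]; exact mem_orbit_self _
  rw [← card_univ, card_eq_sum_card_fiberwise (f := fun g : Γ => g • v₀) (t := S)
    (fun g _ => by rw [hS]; exact ⟨g, rfl⟩), sum_congr rfl (fun a ha => hc _ h0 a ha)]
  simp

/-- Equivariantly assigning to every vertex a nonempty part of the orbit `S` cannot shrink the
relative size of a set. Average over the group: the translates `g • φ (g⁻¹ • w)` of a selection `φ`
of elements of `N w` take every value in `S` equally often. -/
theorem card_mul_le_card_biUnion_mul [Fintype V] (hS : (S : Set V) = orbit Γ v₀) (N : V → Finset V)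
    (hne : ∀ w, (N w).Nonempty) (hNS : ∀ w, N w ⊆ S)
    (hN : ∀ (g : Γ) w, ∀ y ∈ N w, g • y ∈ N (g • w)) (R : Finset V) :
    #R * #S ≤ #(R.biUnion N) * Fintype.card V := by
  obtain ⟨c, hc0, hc⟩ := exists_card_transporter hS
  choose φ hφ using hne
  refine Nat.le_of_mul_le_mul_right ?_ hc0
  calc #R * #S * c = #((univ : Finset Γ) ×ˢ R) := by
        rw [card_product, card_univ, card_eq_mul_of_transporter hS hc]; ring
    _ ≤ ∑ u ∈ R.biUnion N, #{p ∈ (univ : Finset Γ) ×ˢ R | p.1 • φ (p.1⁻¹ • p.2) = u} := by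
        refine (card_eq_sum_card_fiberwise fun p hp => ?_).le
        have h := hN p.1 _ _ (hφ (p.1⁻¹ • p.2))
        rw [smul_inv_smul] at h
        exact mem_biUnion.2 ⟨p.2, (mem_product.1 hp).2, h⟩
    _ ≤ ∑ u ∈ R.biUnion N, Fintype.card V * c := by
        refine sum_le_sum fun u hu => ?_
        obtain ⟨w, -, hw⟩ := mem_biUnion.1 hu
        have huS := hNS _ hw
        calc _ ≤ #{p ∈ (univ : Finset Γ) ×ˢ (univ : Finset V) | p.1 • φ p.2 = u} := by
              refine card_le_card_of_injOn (fun p => (p.1, p.1⁻¹ • p.2)) (fun p hp => ?_) ?_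
              · simp only [coe_filter, mem_product, Set.mem_ofPred_eq] at hp
                simpa using hp.2
              · rintro ⟨g, x⟩ - ⟨g', x'⟩ - h
                simp only [Prod.mk.injEq] at h
                obtain ⟨rfl, h⟩ := h
                simpa using h
          _ = ∑ w : V, #{g : Γ | g • φ w = u} := by
              simp only [card_filter, sum_product_right]
          _ = Fintype.card V * c := by
              rw [sum_congr rfl fun w _ => hc _ (hNS _ (hφ w)) u huS]; simp
    _ = #(R.biUnion N) * Fintype.card V * c := by simp; ring

/-- Some translate of `K` whose base point `v` is moved into `R` has at most the average overlap
with `A`. -/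
theorem exists_smul_card_inter_le (hS : (S : Set V) = orbit Γ v₀) {v : V} (hv : v ∈ S)
    {R K A : Finset V} (hR : R ⊆ S) (hR0 : R.Nonempty) (hK : K ⊆ S) (hA : A ⊆ S) :
    ∃ g : Γ, g • v ∈ R ∧ #(K.image (g • ·) ∩ A) * #R ≤ #K * #A := by
  obtain ⟨c, hc0, hc⟩ := exists_card_transporter hS
  have hcardR : #{g : Γ | g • v ∈ R} = #R * c := by
    rw [card_eq_sum_card_fiberwise (f := fun g : Γ => g • v) (t := R)
      (fun g hg => by simpa using hg)]
    rw [sum_congr rfl (g := fun _ => c) fun a ha => ?_]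
    · simp
    · rw [filter_filter, ← hc v hv a (hR ha)]
      congr 1
      ext g
      simp only [mem_filter_univ, and_iff_right_iff_imp]
      rintro rfl; exact ha
  have htot : ∑ g : Γ, #(K.image (g • ·) ∩ A) = #K * #A * c := by
    have h1 : ∀ g : Γ, #(K.image (g • ·) ∩ A) = ∑ y ∈ K, ∑ a ∈ A, if g • y = a then 1 else 0 := by
      intro g
      have : K.image (g • ·) ∩ A = {y ∈ K | g • y ∈ A}.image (g • ·) := by
        ext z; simp only [mem_inter, mem_image, mem_filter]; grind
      rw [this, card_image_of_injective _ (MulAction.injective g), card_filter]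
      exact sum_congr rfl fun y _ => by simp
    simp only [h1]
    rw [sum_comm, sum_congr rfl fun y _ => sum_comm]
    simp only [← card_filter]
    rw [sum_congr rfl fun y hy => sum_congr rfl fun a ha => hc y (hK hy) a (hA ha)]
    simp [mul_assoc]
  by_contra! h
  have hne : ({g : Γ | g • v ∈ R} : Finset Γ).Nonempty := by
    rw [← card_pos, hcardR]; exact Nat.mul_pos (card_pos.2 hR0) hc0
  have h1 := sum_lt_sum_of_nonempty hne fun g hg => h g (by simpa using hg)
  rw [sum_const, hcardR, smul_eq_mul, ← sum_mul] at h1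
  have h2 : ∑ g : Γ with g • v ∈ R, #(K.image (g • ·) ∩ A) ≤ #K * #A * c :=
    htot ▸ sum_le_sum_of_subset (subset_univ _)
  have h3 := Nat.mul_le_mul_right #R h2
  have h4 : #R * c * (#K * #A) = #K * #A * c * #R := by ring
  omega

end Averaging

end Exploration

/-! ### Exploring an orbit -/

namespace Exploration

open MulAction Finset

variable {V : Type*} {G : ℕ → SimpleGraph V}

/-- The walk `f` visits all vertices of `A` in the time window from `t` to `t + T`. -/
def Covers (f : ℕ → V) (t T : ℕ) (A : Finset V) : Prop :=
  ∀ y ∈ A, ∃ s, t ≤ s ∧ s ≤ t + T ∧ f s = y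

/-- At every time, from every vertex of `S`, some walk visits `k` vertices of `S` within `T`
steps. -/
def Explores (G : ℕ → SimpleGraph V) (S : Finset V) (k T : ℕ) : Prop :=
  ∀ t, ∀ v ∈ S, ∃ f, IsWalk G f ∧ f t = v ∧ ∃ K ⊆ S, #K = k ∧ Covers f t T K

theorem explores_one (S : Finset V) : Explores G S 1 0 := fun t v hv =>
  ⟨_, isWalk_const v, rfl, {v}, by simpa using hv, by simp,
    fun y hy => ⟨t, le_rfl, le_rfl, (mem_singleton.1 hy).symm⟩⟩

variable [Fintype V] {Γ : Type*} [Group Γ] [MulAction Γ V]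
  {S : Finset V} {v₀ : V}

/-- If all orbits have at least as many vertices as `S`, then there are at most `|V| / |S|` of
them. -/
theorem ncard_range_orbit_mul_le (hmin : ∀ x : V, #S ≤ (orbit Γ x).ncard) :
    (Set.range fun x : V => orbit Γ x).ncard * #S ≤ Fintype.card V := by
  classical
  rw [← Set.image_univ, ← coe_univ, ← coe_image, Set.ncard_coe_finset, ← card_univ,
    card_eq_sum_card_image (fun x : V => orbit Γ x) univ, ← smul_eq_mul]
  refine card_nsmul_le_sum _ _ _ fun O hO => ?_
  obtain ⟨x, -, rfl⟩ := mem_image.1 hO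
  refine (hmin x).trans_eq ?_
  rw [← Set.ncard_coe_finset]
  congr 1
  ext y
  simp [orbit_eq_iff]

variable [Fintype Γ]

/-- Within `3 * (|V| / |S|) * m` steps, at least `m` vertices of `S` can be reached: after two
thirds of the time the proportion of reachable vertices is at least `m / |S|`, and every vertex then has
the time to get to `S`. -/
theorem le_card_reach_orbit (hG : ∀ t, (G t).Connected) (hΓ : Preserves Γ G)
    (hS : (S : Set V) = orbit Γ v₀) (hmin : ∀ x : V, #S ≤ (orbit Γ x).ncard) {m : ℕ} (hm : 1 ≤ m)
    (hmS : m ≤ #S) (t : ℕ) (x : V) {R : Finset V}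
    (hR : ∀ y ∈ S, y ∈ reach G t x (3 * (Fintype.card V / #S) * m) → y ∈ R) : m ≤ #R := by
  classical
  set n := Fintype.card V with hn
  set q := n / #S with hq
  have hs : 0 < #S := by omega
  have hr : (Set.range fun x : V => orbit Γ x).ncard ≤ q :=
    (Nat.le_div_iff_mul_le hs).2 (ncard_range_orbit_mul_le hmin)
  have hn0 : 0 < n := Fintype.card_pos_iff.2 ⟨x⟩
  have hq0 : 1 ≤ q := (Nat.le_div_iff_mul_le hs).2 (by simpa using card_le_univ S)
  have hqm : q ≤ q * m := Nat.le_mul_of_pos_right q hm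
  have hmqm : m ≤ q * m := Nat.le_mul_of_pos_left m hq0
  obtain ⟨d, hd⟩ : ∃ d, d + 1 = (q + 1) * m := ⟨(q + 1) * m - 1, by
    have : 0 < (q + 1) * m := by positivity
    omega⟩
  have hd' : d + 1 = q * m + m := by rw [hd, Nat.succ_mul]
  have h3 : 3 * q * m = 3 * (q * m) := mul_assoc _ _ _
  obtain ⟨e, he⟩ : ∃ e, d + e = 3 * q * m := ⟨3 * q * m - d, by omega⟩
  have hre : (Set.range fun x : V => orbit Γ x).ncard ≤ e + 1 := by omega
  let R₀ : Finset V := {y | y ∈ reach G t x d}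
  let N : V → Finset V := fun w => {y ∈ S | y ∈ reach G (t + d) w e}
  have hR₀ : m * n ≤ #R₀ * #S := by
    have h := min_le_ncard_reach hG t x d
    have h1 : (reach G t x d).ncard = #R₀ := by
      rw [← Set.ncard_coe_finset]; congr 1; ext; simp [R₀]
    rw [h1, Nat.card_eq_fintype_card, hd] at h
    have h2 : n ≤ (q + 1) * #S := by
      have := Nat.lt_div_mul_add (a := n) hs
      have h3 : (q + 1) * #S = n / #S * #S + #S := by rw [hq]; ring
      omega
    rcases min_le_iff.1 h with h | h
    · calc m * n ≤ m * ((q + 1) * #S) := Nat.mul_le_mul_left _ h2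
        _ = (q + 1) * m * #S := by ring
        _ ≤ _ := Nat.mul_le_mul_right _ h
    · calc m * n ≤ #S * n := Nat.mul_le_mul_right _ hmS
        _ = n * #S := by ring
        _ ≤ _ := Nat.mul_le_mul_right _ h
  have hN : #R₀ * #S ≤ #(R₀.biUnion N) * n := by
    refine card_mul_le_card_biUnion_mul hS N (fun w => ?_) (fun w => filter_subset _ _)
      (fun g w y hy => ?_) R₀
    · obtain ⟨y, hy, hy'⟩ := exists_mem_orbit_reach hG hΓ (t + d) w v₀ hre
      exact ⟨y, mem_filter.2 ⟨by rw [← mem_coe, hS]; exact hy, hy'⟩⟩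
    · obtain ⟨h1, h2⟩ := mem_filter.1 hy
      refine mem_filter.2 ⟨?_, smul_mem_reach hΓ g h2⟩
      rw [← mem_coe, hS] at h1 ⊢
      exact mapsTo_smul_orbit g v₀ h1
  refine (Nat.le_of_mul_le_mul_right (hR₀.trans hN) hn0).trans (card_le_card fun y hy => ?_)
  obtain ⟨w, hw, hy⟩ := mem_biUnion.1 hy
  obtain ⟨h1, h2⟩ := mem_filter.1 hy
  exact hR y h1 (he ▸ reach_trans (by simpa [R₀] using hw) h2)

/-- A walk that has visited `A` can be continued by travelling for a while and then following a
translate of a walk that visits `k` vertices. As at least `m` starting points for the translate are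
in reach, it may be chosen to revisit no more than a proportion `|A| / m` of its `k` vertices. -/
theorem Explores.exists_extension (hG : ∀ t, (G t).Connected) (hΓ : Preserves Γ G)
    (hS : (S : Set V) = orbit Γ v₀) (hmin : ∀ x : V, #S ≤ (orbit Γ x).ncard) {k T : ℕ}
    (hkT : Explores G S k T) {m : ℕ} (hm : 1 ≤ m) (hmS : m ≤ #S) {f : ℕ → V} (hf : IsWalk G f)
    {t T₀ : ℕ} {A : Finset V} (hA : A ⊆ S) (hfA : Covers f t T₀ A) :
    ∃ f', IsWalk G f' ∧ f' t = f t ∧ ∃ A' ⊆ S,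
      Covers f' t (T₀ + (3 * (Fintype.card V / #S) * m + T)) A' ∧
      #A * m + k * m ≤ #A' * m + k * #A := by
  classical
  set d := 3 * (Fintype.card V / #S) * m with hd
  have hv₀ : v₀ ∈ S := by rw [← mem_coe, hS]; exact mem_orbit_self _
  obtain ⟨h, hh, h0, K, hK, rfl, hhK⟩ := hkT (t + T₀ + d) v₀ hv₀
  let R : Finset V := {y ∈ S | y ∈ reach G (t + T₀) (f (t + T₀)) d}
  have hmR : m ≤ #R := le_card_reach_orbit hG hΓ hS hmin hm hmS (t + T₀) (f (t + T₀))
    fun y h1 h2 => mem_filter.2 ⟨h1, h2⟩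
  obtain ⟨g, hgR, hg⟩ := exists_smul_card_inter_le (Γ := Γ) hS hv₀ (filter_subset _ _)
    (card_pos.1 (by omega : 0 < #R)) hK hA
  obtain ⟨p, hp, hp1, hp2⟩ := (mem_filter.1 hgR).2
  obtain ⟨f₁, hf₁, e1, e2⟩ := hf.exists_concat hp hp1.symm
  obtain ⟨f₂, hf₂, e3, e4⟩ := hf₁.exists_concat (hh.smul hΓ g) (t := t + T₀ + d)
    (by simp only [h0]; rw [e2 _ (by omega), hp2])
  have hsub : K.image (g • ·) ⊆ S := by
    intro y hy
    obtain ⟨z, hz, rfl⟩ := mem_image.1 hy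
    have := hK hz
    rw [← mem_coe, hS] at this ⊢
    exact mapsTo_smul_orbit g v₀ this
  refine ⟨f₂, hf₂, by rw [e3 _ (by omega), e1 _ (by omega)], A ∪ K.image (g • ·),
    union_subset hA hsub, fun y hy => ?_, ?_⟩
  · rcases mem_union.1 hy with hy | hy
    · obtain ⟨s, h1, h2, h3⟩ := hfA y hy
      exact ⟨s, h1, by omega, by rw [e3 _ (by omega), e1 _ (by omega), h3]⟩
    · obtain ⟨z, hz, rfl⟩ := mem_image.1 hy
      obtain ⟨s, h1, h2, h3⟩ := hhK z hz
      exact ⟨s, by omega, by omega, by rw [e4 _ (by omega), h3]⟩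
  · have h1 := card_union_add_card_inter A (K.image (g • ·))
    rw [card_image_of_injective _ (MulAction.injective g), inter_comm] at h1
    have h2 := (Nat.mul_le_mul_left #(K.image (g • ·) ∩ A) hmR).trans hg
    calc #A * m + #K * m = (#A + #K) * m := by ring
      _ = #(A ∪ K.image (g • ·)) * m + #(K.image (g • ·) ∩ A) * m := by rw [← h1]; ring
      _ ≤ _ := by omega

/-- With `2 * b` rounds the number of visited vertices is multiplied by `b`: as long as fewer than
`b * k` vertices are visited, of the `2 * b * k` that are in reach, a round yields at least `k / 2`
new ones. -/
theorem Explores.mul (hG : ∀ t, (G t).Connected) (hΓ : Preserves Γ G)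
    (hS : (S : Set V) = orbit Γ v₀) (hmin : ∀ x : V, #S ≤ (orbit Γ x).ncard) {b k T : ℕ}
    (hkT : Explores G S k T) (hb : 1 ≤ b) (hk : 1 ≤ k) (hbk : 2 * b * k ≤ #S) :
    Explores G S (b * k) (2 * b * (6 * (Fintype.card V / #S) * (b * k) + T)) := by
  intro t v _
  have hbk0 : 0 < b * k := by positivity
  set D := 3 * (Fintype.card V / #S) * (2 * b * k) + T with hD
  have key : ∀ i, ∃ f, IsWalk G f ∧ f t = v ∧ ∃ A ⊆ S, Covers f t (i * D) A ∧
      min (i * k) (2 * (b * k)) ≤ 2 * #A := by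
    intro i
    induction i with
    | zero => exact ⟨_, isWalk_const v, rfl, ∅, by simp, fun y hy => by simp at hy, by simp⟩
    | succ i ih =>
      obtain ⟨f, hf, h0, A, hA, hfA, hi⟩ := ih
      by_cases h : b * k ≤ #A
      · refine ⟨f, hf, h0, A, hA, fun y hy => ?_, by omega⟩
        obtain ⟨s, h1, h2, h3⟩ := hfA y hy
        exact ⟨s, h1, by rw [Nat.succ_mul]; omega, h3⟩
      · obtain ⟨f', hf', h0', A', hA', hfA', hc⟩ := hkT.exists_extension hG hΓ hS hmin
          (m := 2 * b * k) (by nlinarith) hbk hf hA hfA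
        refine ⟨f', hf', by rw [h0', h0], A', hA', by rwa [Nat.succ_mul], ?_⟩
        have h1 : k * #A ≤ k * (b * k) := Nat.mul_le_mul_left _ (by omega)
        have h2 : (2 * #A + k) * (b * k) ≤ 2 * #A' * (b * k) := by nlinarith
        have h3 := Nat.le_of_mul_le_mul_right h2 hbk0
        rw [Nat.succ_mul]
        omega
  obtain ⟨f, hf, h0, A, hA, hfA, hc⟩ := key (2 * b)
  rw [min_eq_left (by rw [mul_assoc])] at hc
  obtain ⟨K, hK, hKc⟩ := exists_subset_card_eq (s := A) (n := b * k) (by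
    rw [mul_assoc] at hc; omega)
  refine ⟨f, hf, h0, K, hK.trans hA, hKc, fun y hy => ?_⟩
  obtain ⟨s, h1, h2, h3⟩ := hfA y (hK hy)
  refine ⟨s, h1, h2.trans_eq ?_, h3⟩
  rw [hD]; ring

theorem explores_pow (hG : ∀ t, (G t).Connected) (hΓ : Preserves Γ G)
    (hS : (S : Set V) = orbit Γ v₀) (hmin : ∀ x : V, #S ≤ (orbit Γ x).ncard) {b : ℕ} (hb : 1 ≤ b)
    (j : ℕ) (hj : ∀ i < j, 2 * b * b ^ i ≤ #S) :
    ∃ T, Explores G S (b ^ j) T ∧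
      T + 12 * (Fintype.card V / #S) * b ^ (j + 1) ≤
        12 * (Fintype.card V / #S) * b ^ (j + 1) * 2 ^ j := by
  induction j with
  | zero => exact ⟨0, by simpa using explores_one S, by simp⟩
  | succ j ih =>
    obtain ⟨T, hT, hTb⟩ := ih fun i hi => hj i (by omega)
    refine ⟨_, by
      rw [pow_succ']
      exact hT.mul hG hΓ hS hmin hb (Nat.one_le_pow _ _ hb) (hj j (by omega)), ?_⟩
    set q := Fintype.card V / #S
    have h := Nat.mul_le_mul_left (2 * b) hTb
    calc _ = 2 * b * (T + 12 * q * b ^ (j + 1)) := by ring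
      _ ≤ _ := h
      _ = _ := by ring

/-- If a proportion of `1 / (2 * b)` of `S` can be visited in one round, then some walk of `i`
rounds leaves at most a proportion of `(1 - 1 / (2 * b)) ^ i` unvisited. -/
theorem Explores.exists_rounds (hG : ∀ t, (G t).Connected) (hΓ : Preserves Γ G)
    (hS : (S : Set V) = orbit Γ v₀) (hmin : ∀ x : V, #S ≤ (orbit Γ x).ncard) {b k T : ℕ}
    (hkT : Explores G S k T) (hk : #S ≤ 2 * b * k) (hb : 1 ≤ b) (t : ℕ) (v : V) (i : ℕ) :
    ∃ f, IsWalk G f ∧ f t = v ∧ ∃ A ⊆ S, Covers f t (i * (3 * Fintype.card V + T)) A ∧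
      (#S - #A : ℝ) ≤ #S * (1 - 1 / (2 * b)) ^ i := by
  have hS0 : 0 < #S := card_pos.2 ⟨v₀, by rw [← mem_coe, hS]; exact mem_orbit_self _⟩
  induction i with
  | zero => exact ⟨_, isWalk_const v, rfl, ∅, by simp, fun y hy => by simp at hy, by simp⟩
  | succ i ih =>
    obtain ⟨f, hf, h0, A, hA, hfA, hi⟩ := ih
    obtain ⟨f', hf', h0', A', hA', hfA', hc⟩ := hkT.exists_extension hG hΓ hS hmin
      (m := #S) hS0 le_rfl hf hA hfA
    refine ⟨f', hf', by rw [h0', h0], A', hA', fun y hy => ?_, ?_⟩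
    · obtain ⟨s, h1, h2, h3⟩ := hfA' y hy
      refine ⟨s, h1, h2.trans ?_, h3⟩
      have h4 : 3 * (Fintype.card V / #S) * #S ≤ 3 * Fintype.card V := by
        rw [mul_assoc]; exact Nat.mul_le_mul_left _ (Nat.div_mul_le_self _ _)
      have h5 := Nat.succ_mul i (3 * Fintype.card V + T)
      simp only [Nat.succ_eq_add_one] at h5
      omega
    · have hSr : (0 : ℝ) < #S := by exact_mod_cast hS0
      have hbr : (1 : ℝ) ≤ b := by exact_mod_cast hb
      have hcr : (#A * #S + k * #S : ℝ) ≤ #A' * #S + k * #A := by exact_mod_cast hc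
      have hAr : (#A : ℝ) ≤ #S := by exact_mod_cast card_le_card hA
      have hkr : (#S : ℝ) ≤ 2 * b * k := by exact_mod_cast hk
      have h1 : (#S : ℝ) * (1 / (2 * b)) ≤ k := by
        rw [mul_one_div, div_le_iff₀ (by positivity)]; linarith
      have h2 : (1 / (2 * b) : ℝ) ≤ 1 := by
        rw [div_le_one (by positivity)]; linarith
      have h3 : (#S - #A' : ℝ) ≤ (#S - #A) * (1 - 1 / (2 * b)) := by
        refine le_of_mul_le_mul_right ?_ hSr
        nlinarith [mul_le_mul_of_nonneg_left h1 (sub_nonneg.2 hAr)]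
      calc (#S - #A' : ℝ) ≤ (#S - #A) * (1 - 1 / (2 * b)) := h3
        _ ≤ #S * (1 - 1 / (2 * b)) ^ i * (1 - 1 / (2 * b)) :=
          mul_le_mul_of_nonneg_right hi (by linarith)
        _ = _ := by ring

/-- An orbit of smallest size can be explored in `O(n ^ (1 + ε))` steps, even if only the visits
from time `n - 1` on count. -/
theorem exists_fast_tour {ε : ℝ} (hε : 0 < ε) : ∃ C : ℝ, ∀ (V : Type u) [Fintype V]
    (Γ : Type u) [Group Γ] [Fintype Γ] [MulAction Γ V] (G : ℕ → SimpleGraph V) (v₀ x : V),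
    (∀ t, (G t).Connected) → Preserves Γ G → (∀ y : V, (orbit Γ v₀).ncard ≤ (orbit Γ y).ncard) →
    ∃ f, IsWalk G f ∧ f 0 = x ∧ ∃ T : ℕ, (T : ℝ) + 1 ≤ C * (Fintype.card V : ℝ) ^ (1 + ε) ∧
      ∀ y ∈ orbit Γ v₀, ∃ t, Fintype.card V - 1 ≤ t ∧ t ≤ T ∧ f t = y := by
  classical
  -- the factor `2 ^ j` lost in `j` rounds of multiplication by `b = 2 ^ p` is at most `n ^ (1 / p)`
  obtain ⟨p, hp⟩ := exists_nat_ge (2 / ε)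
  have hp0 : (0 : ℝ) < p := lt_of_lt_of_le (by positivity) hp
  have hp1 : 1 ≤ p := by exact_mod_cast hp0
  set b := 2 ^ p with hb
  have hb2 : 2 ≤ b := by
    calc 2 = 2 ^ 1 := rfl
      _ ≤ b := Nat.pow_le_pow_right (by norm_num) hp1
  refine ⟨1 + (4 * b / ε + 1) * (15 * b), ?_⟩
  intro V _ Γ _ _ _ G v₀ x hG hΓ hmin'
  set n := Fintype.card V with hn
  let S : Finset V := (orbit Γ v₀).toFinset
  have hS : (S : Set V) = orbit Γ v₀ := by simp [S]
  have hv₀ : v₀ ∈ S := by rw [← mem_coe, hS]; exact mem_orbit_self _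
  have hS0 : 0 < #S := card_pos.2 ⟨v₀, hv₀⟩
  have hmin : ∀ y : V, #S ≤ (orbit Γ y).ncard := by
    intro y; rw [← Set.ncard_coe_finset, hS]; exact hmin' y
  have hSn : #S ≤ n := card_le_univ S
  have hn0 : 1 ≤ n := hS0.trans_le hSn
  -- multiply the number of visited vertices by `b` for as long as `Explores.mul` applies
  have hex : ∃ j, #S < 2 * b * b ^ j := by
    refine ⟨#S, (Nat.lt_pow_self (by omega : 1 < b)).trans_le ?_⟩
    exact Nat.le_mul_of_pos_left _ (by omega)
  obtain ⟨j, hj, hjlt⟩ : ∃ j, #S < 2 * b * b ^ j ∧ ∀ i < j, 2 * b * b ^ i ≤ #S :=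
    ⟨Nat.find hex, Nat.find_spec hex, fun i hi => not_lt.1 (Nat.find_min hex hi)⟩
  have hbj : b ^ j ≤ #S := by
    rcases j with _ | j
    · simpa using hS0
    · calc b ^ (j + 1) = b * b ^ j := pow_succ' _ _
        _ ≤ 2 * b * b ^ j := by rw [mul_assoc]; omega
        _ ≤ _ := hjlt j (by omega)
  obtain ⟨T, hT, hTb⟩ := explores_pow hG hΓ hS hmin (by omega : 1 ≤ b) j hjlt
  have hT' : T ≤ 12 * b * n * 2 ^ j := by
    calc T ≤ 12 * (n / #S) * b ^ (j + 1) * 2 ^ j := (Nat.le_add_right _ _).trans hTb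
      _ = 12 * b * (n / #S * b ^ j) * 2 ^ j := by ring
      _ ≤ 12 * b * (n / #S * #S) * 2 ^ j := by gcongr
      _ ≤ _ := by gcongr; exact Nat.div_mul_le_self _ _
  obtain ⟨f₀, hf₀, hf0, hf1⟩ := mem_reach_of_card_le hG 0 x v₀ (d := n - 1)
    (by rw [Nat.card_eq_fintype_card]; omega)
  -- the number of rounds of `Explores.exists_rounds` after which less than one vertex is left
  set i := ⌊2 * b * Real.log #S⌋₊ + 1 with hi
  obtain ⟨f₁, hf₁, hf2, A, hA, hcov, hrem⟩ :=
    hT.exists_rounds hG hΓ hS hmin hj.le (by omega) (n - 1) v₀ i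
  have hSr : (0 : ℝ) < #S := by exact_mod_cast hS0
  have hS1 : (1 : ℝ) ≤ #S := by exact_mod_cast hS0
  have hbr : (2 : ℝ) ≤ b := by exact_mod_cast hb2
  have hAS : A = S := by
    refine eq_of_subset_of_card_le hA ?_
    have h1 : 2 * b * Real.log #S < i := by
      rw [hi]; push_cast; exact Nat.lt_floor_add_one _
    have h2 : (1 - 1 / (2 * b) : ℝ) ^ i ≤ Real.exp (-(i / (2 * b))) := by
      have h3 : (1 - 1 / (2 * b) : ℝ) ≤ Real.exp (-(1 / (2 * b))) := by
        have := Real.add_one_le_exp (-(1 / (2 * b) : ℝ)); linarith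
      have h4 : (0 : ℝ) ≤ 1 - 1 / (2 * b) := by
        rw [sub_nonneg, div_le_one (by positivity)]; linarith
      refine (pow_le_pow_left₀ h4 h3 i).trans_eq ?_
      rw [← Real.exp_nat_mul]; congr 1; ring
    have h5 : Real.exp (-(i / (2 * b))) < (#S : ℝ)⁻¹ := by
      rw [← Real.exp_log (inv_pos.2 hSr), Real.exp_lt_exp, Real.log_inv, neg_lt_neg_iff,
        lt_div_iff₀ (by positivity)]
      linarith
    have h6 : (#S - #A : ℝ) < 1 := by
      calc (#S - #A : ℝ) ≤ #S * (1 - 1 / (2 * b)) ^ i := hrem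
        _ ≤ #S * Real.exp (-(i / (2 * b))) := by gcongr
        _ < #S * (#S : ℝ)⁻¹ := by gcongr
        _ = 1 := mul_inv_cancel₀ hSr.ne'
    have h7 : (#S : ℝ) < #A + 1 := by linarith
    exact Nat.lt_succ_iff.1 (by exact_mod_cast h7)
  obtain ⟨f, hf, e1, e2⟩ := hf₀.exists_concat hf₁ (t := n - 1) (by rw [hf2, ← hf1, zero_add])
  refine ⟨f, hf, by rw [e1 _ (by omega), hf0], (n - 1) + i * (3 * n + T), ?_, fun y hy => ?_⟩
  swap
  · obtain ⟨s, h1, h2, h3⟩ := hcov y (by rw [hAS, ← mem_coe, hS]; exact hy)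
    exact ⟨s, h1, h2, by rw [e2 _ h1, h3]⟩
  -- it remains to bound the number of rounds and the factor `2 ^ j` by powers of `n`
  have hnr : (1 : ℝ) ≤ n := by exact_mod_cast hn0
  have hnr0 : (0 : ℝ) < n := by linarith
  have h2j : (2 : ℝ) ^ j ≤ (n : ℝ) ^ (ε / 2) := by
    have h1 : ((2 : ℝ) ^ j) ^ (p : ℝ) ≤ n := by
      rw [Real.rpow_natCast, ← pow_mul, mul_comm, pow_mul]
      exact_mod_cast hbj.trans hSn
    calc (2 : ℝ) ^ j = (((2 : ℝ) ^ j) ^ (p : ℝ)) ^ ((p : ℝ)⁻¹) :=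
          (Real.rpow_rpow_inv (by positivity) hp0.ne').symm
      _ ≤ (n : ℝ) ^ ((p : ℝ)⁻¹) := Real.rpow_le_rpow (by positivity) h1 (by positivity)
      _ ≤ (n : ℝ) ^ (ε / 2) := by
          refine Real.rpow_le_rpow_of_exponent_le hnr ?_
          rw [inv_le_comm₀ hp0 (by positivity), inv_div]; exact hp
  have hir : (i : ℝ) ≤ (4 * b / ε + 1) * (n : ℝ) ^ (ε / 2) := by
    have h1 : (1 : ℝ) ≤ (n : ℝ) ^ (ε / 2) := Real.one_le_rpow hnr (by positivity)
    have h2 : Real.log #S ≤ (n : ℝ) ^ (ε / 2) / (ε / 2) :=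
      (Real.log_le_log hSr (by exact_mod_cast hSn)).trans
        (Real.log_le_rpow_div hnr0.le (by positivity))
    calc (i : ℝ) ≤ 2 * b * Real.log #S + 1 := by
          rw [hi]; push_cast
          gcongr
          exact Nat.floor_le (mul_nonneg (by positivity) (Real.log_nonneg hS1))
      _ ≤ 2 * b * ((n : ℝ) ^ (ε / 2) / (ε / 2)) + (n : ℝ) ^ (ε / 2) := by gcongr
      _ = _ := by field_simp; ring
  have hTr : (3 * n + T : ℝ) ≤ 15 * b * n * (n : ℝ) ^ (ε / 2) := by
    have h1 : 3 * n + T ≤ 15 * b * n * 2 ^ j := by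
      have : n ≤ b * n * 2 ^ j :=
        (Nat.le_mul_of_pos_left n (by omega : 0 < b)).trans
          (Nat.le_mul_of_pos_right _ (by positivity))
      nlinarith
    calc (3 * n + T : ℝ) ≤ 15 * b * n * 2 ^ j := by exact_mod_cast h1
      _ ≤ _ := by gcongr
  have hpow : (n : ℝ) * ((n : ℝ) ^ (ε / 2) * (n : ℝ) ^ (ε / 2)) = (n : ℝ) ^ (1 + ε) := by
    rw [← Real.rpow_add hnr0, add_halves, Real.rpow_add hnr0, Real.rpow_one]
  have hn1 : ((n - 1 : ℕ) : ℝ) + 1 = n := by exact_mod_cast Nat.sub_add_cancel hn0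
  calc (((n - 1) + i * (3 * n + T) : ℕ) : ℝ) + 1 = n + i * (3 * n + T) := by
        push_cast; rw [← hn1]; ring
    _ ≤ (n : ℝ) ^ (1 + ε) + ((4 * b / ε + 1) * (n : ℝ) ^ (ε / 2)) *
          (15 * b * n * (n : ℝ) ^ (ε / 2)) := by
        gcongr
        exact Real.self_le_rpow_of_one_le hnr (by linarith)
    _ = (n : ℝ) ^ (1 + ε) + (4 * b / ε + 1) * (15 * b) *
          (n * ((n : ℝ) ^ (ε / 2) * (n : ℝ) ^ (ε / 2))) := by ring
    _ = _ := by rw [hpow]; ring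

/-- The vertices of `S` can be visited one by one, with `n - 1` steps for each of them. -/
theorem exists_slow_tour (hG : ∀ t, (G t).Connected) (x : V) (S : Finset V) :
    ∃ f, IsWalk G f ∧ f 0 = x ∧ ∀ y ∈ S, ∃ t, Fintype.card V - 1 ≤ t ∧
      t ≤ #S * (Fintype.card V - 1) ∧ f t = y := by
  classical
  induction S using Finset.induction_on with
  | empty => exact ⟨_, isWalk_const x, rfl, by simp⟩
  | insert a S ha ih =>
    obtain ⟨f, hf, h0, h⟩ := ih
    obtain ⟨g, hg, h1, h2⟩ := mem_reach_of_card_le hG (#S * (Fintype.card V - 1))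
      (f (#S * (Fintype.card V - 1))) a (d := Fintype.card V - 1)
      (by rw [Nat.card_eq_fintype_card]; omega)
    obtain ⟨p, hp, e1, e2⟩ := hf.exists_concat hg h1.symm
    refine ⟨p, hp, by rw [e1 _ (by omega), h0], fun y hy => ?_⟩
    rw [card_insert_of_notMem ha, Nat.succ_mul]
    rcases mem_insert.1 hy with rfl | hy
    · exact ⟨_, by omega, le_rfl, by rw [e2 _ (by omega), h2]⟩
    · obtain ⟨s, h3, h4, h5⟩ := h y hy
      exact ⟨s, h3, by omega, by rw [e1 _ h4, h5]⟩

end Exploration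

/-! ### A canonical orbit of smallest size -/

namespace TemporalGraph

open MulAction

variable {V : Type u} {W : Type v} {ℓ : ℕ} {G : TemporalGraph V ℓ} {H : TemporalGraph W ℓ}

theorem IsIso.symm {θ : V ≃ W} (h : G.IsIso H θ) : H.IsIso G θ.symm := fun t x y => by
  simpa using (h t (θ.symm x) (θ.symm y)).symm

theorem IsIso.trans {X : Type*} {K : TemporalGraph X ℓ} {θ : V ≃ W} {η : W ≃ X}
    (h : G.IsIso H θ) (h' : H.IsIso K η) : G.IsIso K (θ.trans η) :=
  fun t x y => (h' t _ _).trans (h t x y)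

theorem isIso_relabel (G : TemporalGraph V ℓ) (lab : V ≃ W) : G.IsIso (G.relabel lab) lab :=
  fun t x y => by simp [relabel]

theorem IsIso.smul_mem_orbit {θ : V ≃ W} (h : G.IsIso H θ) {x y : V}
    (hy : y ∈ orbit G.aut x) : θ y ∈ orbit H.aut (θ x) := by
  obtain ⟨σ, rfl⟩ := hy
  exact ⟨⟨(θ.symm.trans (σ : Equiv.Perm V)).trans θ, (h.symm.trans σ.2).trans h⟩,
    by simp [Subgroup.smul_def]⟩

theorem IsIso.image_orbit {θ : V ≃ W} (h : G.IsIso H θ) (x : V) :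
    θ '' orbit G.aut x = orbit H.aut (θ x) := by
  ext y
  constructor
  · rintro ⟨z, hz, rfl⟩
    exact h.smul_mem_orbit hz
  · intro hy
    have h2 := h.symm.smul_mem_orbit hy
    rw [θ.symm_apply_apply] at h2
    exact ⟨_, h2, θ.apply_symm_apply y⟩

/-- The orbit of `x` has the smallest size among all orbits. -/
def IsSmall (G : TemporalGraph V ℓ) (x : V) : Prop :=
  ∀ y : V, (orbit G.aut x).ncard ≤ (orbit G.aut y).ncard

theorem IsIso.isSmall {θ : V ≃ W} (h : G.IsIso H θ) {x : V} (hx : G.IsSmall x) :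
    H.IsSmall (θ x) := by
  intro y
  rw [← h.image_orbit, Set.ncard_image_of_injective _ θ.injective, ← θ.apply_symm_apply y,
    ← h.image_orbit, Set.ncard_image_of_injective _ θ.injective]
  exact hx _

/-- A number that encodes the adjacency matrices of `G` in the labels `lab`, together with the label
of `x`. -/
noncomputable def code (G : TemporalGraph V ℓ) {n : ℕ} (lab : V ≃ Fin n) (x : V) : ℕ :=
  Encodable.encode ((G.relabel lab).matrices, (lab x : ℕ))

theorem IsIso.relabel_eq {θ : V ≃ W} (h : G.IsIso H θ) {X : Type*} (lab : W ≃ X) :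
    H.relabel lab = G.relabel (θ.trans lab) := by
  simp only [relabel]
  congr 1
  ext t x y
  simpa using (h.symm t (lab.symm x) (lab.symm y)).symm

theorem IsIso.code_apply {θ : V ≃ W} (h : G.IsIso H θ) {n : ℕ} (lab : W ≃ Fin n) (x : V) :
    H.code lab (θ x) = G.code (θ.trans lab) x := by
  simp only [code, h.relabel_eq, Equiv.trans_apply]

/-- The vertices which, in a suitable labelling, attain the smallest code among the vertices with an
orbit of smallest size. As a code determines the temporal graph and the vertex up to isomorphism,
they form one orbit. -/
def leastOrbit (G : TemporalGraph V ℓ) : Set V :=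
  {x | G.IsSmall x ∧ ∃ (n : ℕ) (lab : V ≃ Fin n), ∀ (m : ℕ) (lab' : V ≃ Fin m) (y : V),
    G.IsSmall y → G.code lab x ≤ G.code lab' y}

theorem IsIso.mem_leastOrbit {θ : V ≃ W} (h : G.IsIso H θ) {x : V} (hx : x ∈ G.leastOrbit) :
    θ x ∈ H.leastOrbit := by
  obtain ⟨hx, n, lab, hlab⟩ := hx
  refine ⟨h.isSmall hx, n, θ.symm.trans lab, fun m lab' y hy => ?_⟩
  rw [h.code_apply, ← θ.apply_symm_apply y, h.code_apply, ← Equiv.trans_assoc,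
    Equiv.self_trans_symm, Equiv.refl_trans]
  exact hlab m _ _ (h.symm.isSmall hy)

theorem IsIso.image_leastOrbit {θ : V ≃ W} (h : G.IsIso H θ) :
    θ '' G.leastOrbit = H.leastOrbit := by
  ext y
  constructor
  · rintro ⟨x, hx, rfl⟩
    exact h.mem_leastOrbit hx
  · exact fun hy => ⟨_, h.symm.mem_leastOrbit hy, θ.apply_symm_apply y⟩

theorem matrices_injective {n : ℕ} :
    Function.Injective (matrices : TemporalGraph (Fin n) ℓ → List (List (List Bool))) := by
  rintro ⟨G⟩ ⟨H⟩ h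
  simp only [matrices, List.ofFn_inj, funext_iff, decide_eq_decide] at h
  congr 1
  ext t x y
  exact h t x y

theorem isIso_of_relabel_eq {X : Type*} {lab : V ≃ X} {lab' : W ≃ X}
    (h : G.relabel lab = H.relabel lab') : G.IsIso H (lab.trans lab'.symm) := by
  have h1 := isIso_relabel G lab
  rw [h] at h1
  exact h1.trans (isIso_relabel H lab').symm

/-- If `x` and `y` have the same code, then composing the two labellings yields an isomorphism that
takes `x` to `y`. -/
theorem exists_aut_of_code_eq {n m : ℕ} {lab : V ≃ Fin n} {lab' : V ≃ Fin m} {x y : V}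
    (h : G.code lab x = G.code lab' y) : y ∈ orbit G.aut x := by
  obtain rfl : n = m := by simpa using Fintype.card_congr (lab.symm.trans lab')
  have h1 := Encodable.encode_injective h
  rw [Prod.mk.injEq] at h1
  refine ⟨⟨_, isIso_of_relabel_eq (matrices_injective h1.1)⟩, ?_⟩
  simp [Subgroup.smul_def, Fin.ext h1.2]

theorem leastOrbit_eq_orbit {x : V} (hx : x ∈ G.leastOrbit) : G.leastOrbit = orbit G.aut x := by
  ext y
  constructor
  · intro hy
    obtain ⟨hx, n, lab, hlab⟩ := hx
    obtain ⟨hy, m, lab', hlab'⟩ := hy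
    exact exists_aut_of_code_eq ((hlab _ _ _ hy).antisymm (hlab' _ _ _ hx))
  · rintro ⟨σ, rfl⟩
    exact IsIso.mem_leastOrbit (H := G) σ.2 hx

theorem exists_mem_leastOrbit [Finite V] [Nonempty V] (G : TemporalGraph V ℓ) :
    ∃ x, x ∈ G.leastOrbit := by
  obtain ⟨z, hz⟩ := Finite.exists_min fun x : V => (orbit G.aut x).ncard
  obtain ⟨n, ⟨lab⟩⟩ := Finite.exists_equiv_fin V
  let P : Set ℕ := {c | ∃ (n : ℕ) (lab : V ≃ Fin n) (x : V), G.IsSmall x ∧ G.code lab x = c}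
  have hP : P.Nonempty := ⟨_, n, lab, z, hz, rfl⟩
  obtain ⟨n, lab, x, hx, hc⟩ := Nat.sInf_mem hP
  exact ⟨x, hx, n, lab, fun m lab' y hy => hc ▸ Nat.sInf_le ⟨m, lab', y, hy, rfl⟩⟩

theorem isCanonicalSmallestOrbit_leastOrbit :
    IsCanonicalSmallestOrbit.{u} fun _ _ G => G.leastOrbit where
  mem_orbits V _ _ ℓ G := by
    obtain ⟨x, hx⟩ := G.exists_mem_leastOrbit
    exact ⟨x, (leastOrbit_eq_orbit hx).symm⟩
  ncard_le V _ _ ℓ G := by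
    rintro _ ⟨y, rfl⟩
    obtain ⟨x, hx⟩ := G.exists_mem_leastOrbit
    dsimp only
    rw [leastOrbit_eq_orbit hx]
    exact hx.1 y
  image_eq _ _ _ _ _ _ _ _ h := h.image_leastOrbit

end TemporalGraph

/-! ### Primitive recursive searches -/

namespace Exploration

open Classical in
/-- The first element of a list with a given property, or a default value. -/
noncomputable def search {β : Type*} [Inhabited β] (L : List β) (p : β → Prop) : β :=
  (L.filter fun b => decide (p b)).headI

theorem search_spec {β : Type*} [Inhabited β] {L : List β} {p : β → Prop} (h : ∃ b ∈ L, p b) :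
    search L p ∈ L ∧ p (search L p) := by
  classical
  obtain ⟨b, hb, hpb⟩ := h
  have h1 : search L p ∈ L.filter fun b => decide (p b) := by
    unfold search
    cases hF : L.filter fun b => decide (p b) with
    | nil => exact absurd (List.mem_filter.2 ⟨hb, decide_eq_true hpb⟩) (by rw [hF]; simp)
    | cons a F => simp
  simpa using List.mem_filter.1 h1

section Primrec

variable {α β : Type*} [Primcodable α] [Primcodable β]

theorem primrecPred_forall_mem {L : α → List β} {p : α → β → Prop} (hL : Primrec L)
    (hp : PrimrecPred fun q : α × β => p q.1 q.2) : PrimrecPred fun a => ∀ b ∈ L a, p a b :=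
  (PrimrecRel.forall_mem_list (R := fun b a => p a b)
    (PrimrecRel.swap (r := p) hp)).comp hL Primrec.id

theorem primrecPred_exists_mem {L : α → List β} {p : α → β → Prop} (hL : Primrec L)
    (hp : PrimrecPred fun q : α × β => p q.1 q.2) : PrimrecPred fun a => ∃ b ∈ L a, p a b :=
  (PrimrecRel.exists_mem_list (R := fun b a => p a b)
    (PrimrecRel.swap (r := p) hp)).comp hL Primrec.id

theorem primrecPred_forall_lt {n : α → ℕ} {p : α → ℕ → Prop} (hn : Primrec n)
    (hp : PrimrecPred fun q : α × ℕ => p q.1 q.2) : PrimrecPred fun a => ∀ i < n a, p a i :=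
  (primrecPred_forall_mem (Primrec.list_range.comp hn) hp).of_eq fun a => by simp

theorem primrecPred_exists_lt {n : α → ℕ} {p : α → ℕ → Prop} (hn : Primrec n)
    (hp : PrimrecPred fun q : α × ℕ => p q.1 q.2) : PrimrecPred fun a => ∃ i < n a, p a i :=
  (primrecPred_exists_mem (Primrec.list_range.comp hn) hp).of_eq fun a => by simp

theorem primrecPred_imp {p q : α → Prop} (hp : PrimrecPred p) (hq : PrimrecPred q) :
    PrimrecPred fun a => p a → q a :=
  (hp.not.or hq).of_eq fun _ => imp_iff_not_or.symm

theorem primrec_filter {L : α → List β} {p : α → β → Prop} [h : ∀ a b, Decidable (p a b)]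
    (hL : Primrec L)
    (hp : PrimrecPred fun q : α × β => p q.1 q.2) :
    Primrec fun a => (L a).filter fun b => decide (p a b) :=
  letI : DecidableRel fun b a => p a b := fun b a => h a b
  (PrimrecRel.listFilter (R := fun b a => p a b)
    (PrimrecRel.swap (r := p) hp)).comp hL Primrec.id

theorem primrec_search [Inhabited β] {L : α → List β} {p : α → β → Prop} (hL : Primrec L)
    (hp : PrimrecPred fun q : α × β => p q.1 q.2) : Primrec fun a => search (L a) (p a) :=
  Primrec.list_headI.comp
    (primrec_filter (h := fun a b => Classical.propDecidable (p a b)) hL hp)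

end Primrec

/-- All lists of `k` numbers smaller than `n`. -/
def tuples (n : ℕ) : ℕ → List (List ℕ)
  | 0 => [[]]
  | k + 1 => (tuples n k).flatMap fun w => (List.range n).map fun i => i :: w

theorem mem_tuples {n k : ℕ} {w : List ℕ} :
    w ∈ tuples n k ↔ ∃ f : Fin k → Fin n, w = List.ofFn fun i => (f i : ℕ) := by
  induction k generalizing w with
  | zero => simp [tuples]
  | succ k ih =>
    simp only [tuples, List.mem_flatMap, List.mem_map, List.mem_range]
    constructor
    · rintro ⟨w, hw, i, hi, rfl⟩
      obtain ⟨f, rfl⟩ := ih.1 hw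
      exact ⟨Fin.cons ⟨i, hi⟩ f, by simp [List.ofFn_succ]⟩
    · rintro ⟨f, rfl⟩
      exact ⟨_, ih.2 ⟨fun i => f i.succ, rfl⟩, f 0, (f 0).2, by simp [List.ofFn_succ]⟩

theorem primrec_tuples {α : Type*} [Primcodable α] {n k : α → ℕ} (hn : Primrec n)
    (hk : Primrec k) : Primrec fun a => tuples (n a) (k a) := by
  have h : Primrec fun a => Nat.rec (motive := fun _ => List (List ℕ)) [[]]
      (fun _ L => L.flatMap fun w => (List.range (n a)).map fun i => i :: w) (k a) := by
    refine Primrec.nat_rec' (f := k) (g := fun _ => [[]]) (h := fun a p =>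
      p.2.flatMap fun w => (List.range (n a)).map fun i => i :: w) hk (Primrec.const _) ?_
    refine Primrec.list_flatMap (Primrec.snd.comp Primrec.snd) ?_
    refine Primrec.list_map (Primrec.list_range.comp
      (hn.comp (Primrec.fst.comp Primrec.fst))) ?_
    exact Primrec.list_cons.comp Primrec.snd (Primrec.snd.comp Primrec.fst)
  refine h.of_eq fun a => ?_
  induction k a with
  | zero => rfl
  | succ k ih => simp only [ih, tuples]

/-- The lists of the values of the permutations of `0, …, n - 1`. -/
def perms (n : ℕ) : List (List ℕ) :=
  (tuples n n).filter fun w => decide (∀ i < n, ∃ j ∈ w, j = i)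

theorem mem_perms {n : ℕ} {w : List ℕ} :
    w ∈ perms n ↔ ∃ σ : Equiv.Perm (Fin n), w = List.ofFn fun i => (σ i : ℕ) := by
  simp only [perms, List.mem_filter, decide_eq_true_eq, mem_tuples]
  constructor
  · rintro ⟨⟨f, rfl⟩, h⟩
    have hf : Function.Surjective f := by
      intro i
      obtain ⟨j, hj, hji⟩ := h i i.2
      obtain ⟨k, rfl⟩ := (List.mem_ofFn' _ _).1 hj
      exact ⟨k, Fin.ext hji⟩
    exact ⟨Equiv.ofBijective f ⟨Finite.injective_iff_surjective.2 hf, hf⟩, rfl⟩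
  · rintro ⟨σ, rfl⟩
    exact ⟨⟨σ, rfl⟩, fun i hi => ⟨i, (List.mem_ofFn' _ _).2 ⟨σ.symm ⟨i, hi⟩, by simp⟩, rfl⟩⟩

theorem primrec_perms : Primrec perms :=
  primrec_filter (p := fun n w => ∀ i < n, ∃ j ∈ w, j = i) (primrec_tuples Primrec.id Primrec.id)
    (primrecPred_forall_lt Primrec.fst (primrecPred_exists_mem (Primrec.snd.comp Primrec.fst)
      (Primrec.eq.comp Primrec.snd (Primrec.snd.comp Primrec.fst))))

/-! ### Computations with adjacency matrices -/

/-- The entry `(i, j)` of the adjacency matrix of time step `t + 1`. -/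
def adjEntry (M : List (List (List Bool))) (t i j : ℕ) : Bool :=
  ((M.getD t []).getD i []).getD j false

/-- The number of vertices, read off from the first adjacency matrix; it is `0` if there is no time
step. -/
def order (M : List (List (List Bool))) : ℕ := (M.getD 0 []).length

/-- The matrices of the temporal graph in which the vertex `w[i]` is renamed `i`. -/
def permute (M : List (List (List Bool))) (w : List ℕ) : List (List (List Bool)) :=
  (List.range M.length).map fun t => (List.range (order M)).map fun i =>
    (List.range (order M)).map fun j => adjEntry M t (w.getD i 0) (w.getD j 0)

/-- The number of vertices in the orbit of `x`. The automorphisms are the permutations that leave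
the matrices unchanged. -/
def orbitSize (M : List (List (List Bool))) (x : ℕ) : ℕ :=
  ((List.range (order M)).filter fun y =>
    decide (∃ w ∈ perms (order M), permute M w = M ∧ w.getD x 0 = y)).length

/-- The orbit of `x` has smallest size. -/
def Small (M : List (List (List Bool))) (x : ℕ) : Prop :=
  ∀ y < order M, orbitSize M x ≤ orbitSize M y

/-- The vertex `x` belongs to the canonical orbit of smallest size. The list `w` plays the role of
the inverse of a labelling in `TemporalGraph.leastOrbit`: it maps labels to vertices. -/
def InOrbit (M : List (List (List Bool))) (x : ℕ) : Prop :=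
  Small M x ∧ ∃ w ∈ perms (order M), ∃ i < order M, w.getD i 0 = x ∧
    ∀ w' ∈ perms (order M), ∀ j < order M, Small M (w'.getD j 0) →
      Encodable.encode (permute M w, i) ≤ Encodable.encode (permute M w', j)

/-- The list `w` describes a temporal walk that starts at `x`. -/
def ValidWalk (M : List (List (List Bool))) (x : ℕ) (w : List ℕ) : Prop :=
  (∀ t < M.length - 1, w.getD (t + 1) 0 = w.getD t 0 ∨
    adjEntry M t (w.getD t 0) (w.getD (t + 1) 0) = true) ∧ w.getD 0 0 = x

/-- From index `n - 1` on, `w` stays at one vertex of the canonical orbit. -/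
def Parks (M : List (List (List Bool))) (w : List ℕ) : Prop :=
  ∃ y < order M, InOrbit M y ∧ ∀ t < M.length, order M - 1 ≤ t → w.getD t 0 = y

/-- Between the indices `n - 1` and `T`, `w` visits all vertices of the canonical orbit. -/
def Tours (M : List (List (List Bool))) (T : ℕ) (w : List ℕ) : Prop :=
  ∀ y < order M, InOrbit M y → ∃ t < T + 1, order M - 1 ≤ t ∧ w.getD t 0 = y

/-- The walk of agent 1. -/
noncomputable def parkingWalk (c : List (List (List Bool)) × ℕ) : List ℕ :=
  search (tuples (order c.1) c.1.length) fun w => ValidWalk c.1 c.2 w ∧ Parks c.1 w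

/-- The walk of agent 2: its tour of the canonical orbit ends as early as possible. -/
noncomputable def touringWalk (c : List (List (List Bool)) × ℕ) : List ℕ :=
  search (tuples (order c.1) c.1.length) fun w => ValidWalk c.1 c.2 w ∧
    ∃ T < c.1.length, Tours c.1 T w ∧ ∀ T' < T, ∀ w' ∈ tuples (order c.1) c.1.length,
      ValidWalk c.1 c.2 w' → ¬ Tours c.1 T' w'

section Primrec

variable {α : Type*} [Primcodable α] {M : α → List (List (List Bool))} {t i j x T : α → ℕ}
  {w : α → List ℕ}

theorem primrec_adjEntry (hM : Primrec M) (ht : Primrec t) (hi : Primrec i) (hj : Primrec j) :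
    Primrec fun a => adjEntry (M a) (t a) (i a) (j a) :=
  (Primrec.list_getD _).comp ((Primrec.list_getD _).comp ((Primrec.list_getD _).comp hM ht) hi) hj

theorem primrec_order (hM : Primrec M) : Primrec fun a => order (M a) :=
  Primrec.list_length.comp ((Primrec.list_getD _).comp hM (Primrec.const 0))

theorem primrec_entry (hw : Primrec w) (hi : Primrec i) : Primrec fun a => (w a).getD (i a) 0 :=
  (Primrec.list_getD _).comp hw hi

theorem primrec_permute (hM : Primrec M) (hw : Primrec w) :
    Primrec fun a => permute (M a) (w a) := by
  refine Primrec.list_map (Primrec.list_range.comp (Primrec.list_length.comp hM)) ?_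
  refine Primrec.list_map (Primrec.list_range.comp (primrec_order (hM.comp Primrec.fst))) ?_
  refine Primrec.list_map
    (Primrec.list_range.comp (primrec_order (hM.comp (Primrec.fst.comp Primrec.fst)))) ?_
  have h0 : Primrec fun q : ((α × ℕ) × ℕ) × ℕ => q.1.1.1 :=
    Primrec.fst.comp (Primrec.fst.comp Primrec.fst)
  exact primrec_adjEntry (hM.comp h0) (Primrec.snd.comp (Primrec.fst.comp Primrec.fst))
    (primrec_entry (hw.comp h0) (Primrec.snd.comp Primrec.fst))
    (primrec_entry (hw.comp h0) Primrec.snd)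

theorem primrec_orbitSize (hM : Primrec M) (hx : Primrec x) :
    Primrec fun a => orbitSize (M a) (x a) := by
  refine Primrec.list_length.comp
    (primrec_filter (Primrec.list_range.comp (primrec_order hM)) ?_)
  refine primrecPred_exists_mem (primrec_perms.comp (primrec_order (hM.comp Primrec.fst))) ?_
  have h0 : Primrec fun q : (α × ℕ) × List ℕ => q.1.1 := Primrec.fst.comp Primrec.fst
  exact (Primrec.eq.comp (primrec_permute (hM.comp h0) Primrec.snd) (hM.comp h0)).and
    (Primrec.eq.comp (primrec_entry Primrec.snd (hx.comp h0)) (Primrec.snd.comp Primrec.fst))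

theorem primrecPred_small (hM : Primrec M) (hx : Primrec x) :
    PrimrecPred fun a => Small (M a) (x a) :=
  primrecPred_forall_lt (primrec_order hM) (Primrec.nat_le.comp
    (primrec_orbitSize (hM.comp Primrec.fst) (hx.comp Primrec.fst))
    (primrec_orbitSize (hM.comp Primrec.fst) Primrec.snd))

theorem primrecPred_inOrbit (hM : Primrec M) (hx : Primrec x) :
    PrimrecPred fun a => InOrbit (M a) (x a) := by
  refine (primrecPred_small hM hx).and ?_
  refine primrecPred_exists_mem (primrec_perms.comp (primrec_order hM)) ?_
  refine primrecPred_exists_lt (primrec_order (hM.comp Primrec.fst)) ?_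
  have h2 : Primrec fun q : (α × List ℕ) × ℕ => q.1.1 := Primrec.fst.comp Primrec.fst
  refine (Primrec.eq.comp (primrec_entry (Primrec.snd.comp Primrec.fst) Primrec.snd)
    (hx.comp h2)).and ?_
  refine primrecPred_forall_mem (primrec_perms.comp (primrec_order (hM.comp h2))) ?_
  refine primrecPred_forall_lt (primrec_order (hM.comp (h2.comp Primrec.fst))) ?_
  have h4 : Primrec fun q : (((α × List ℕ) × ℕ) × List ℕ) × ℕ => q.1.1.1.1 :=
    h2.comp (Primrec.fst.comp Primrec.fst)
  have hw' : Primrec fun q : (((α × List ℕ) × ℕ) × List ℕ) × ℕ => q.1.2 :=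
    Primrec.snd.comp Primrec.fst
  refine primrecPred_imp (primrecPred_small (hM.comp h4) (primrec_entry hw' Primrec.snd)) ?_
  refine Primrec.nat_le.comp (Primrec.encode.comp (Primrec.pair (primrec_permute (hM.comp h4) ?_)
    ?_)) (Primrec.encode.comp (Primrec.pair (primrec_permute (hM.comp h4) hw') Primrec.snd))
  · exact Primrec.snd.comp (Primrec.fst.comp (Primrec.fst.comp Primrec.fst))
  · exact Primrec.snd.comp (Primrec.fst.comp Primrec.fst)

theorem primrecPred_validWalk (hM : Primrec M) (hx : Primrec x) (hw : Primrec w) :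
    PrimrecPred fun a => ValidWalk (M a) (x a) (w a) := by
  refine PrimrecPred.and (primrecPred_forall_lt
    (Primrec.nat_sub.comp (Primrec.list_length.comp hM) (Primrec.const 1)) ?_)
    (Primrec.eq.comp (primrec_entry hw (Primrec.const 0)) hx)
  have h1 := primrec_entry (hw.comp (Primrec.fst (β := ℕ))) Primrec.snd
  have h2 := primrec_entry (hw.comp (Primrec.fst (β := ℕ))) (Primrec.succ.comp Primrec.snd)
  exact (Primrec.eq.comp h2 h1).or (Primrec.eq.comp
    (primrec_adjEntry (hM.comp Primrec.fst) Primrec.snd h1 h2) (Primrec.const true))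

theorem primrecPred_parks (hM : Primrec M) (hw : Primrec w) :
    PrimrecPred fun a => Parks (M a) (w a) := by
  refine primrecPred_exists_lt (primrec_order hM)
    ((primrecPred_inOrbit (hM.comp Primrec.fst) Primrec.snd).and ?_)
  refine primrecPred_forall_lt (Primrec.list_length.comp (hM.comp Primrec.fst)) ?_
  have h0 : Primrec fun q : (α × ℕ) × ℕ => q.1.1 := Primrec.fst.comp Primrec.fst
  exact primrecPred_imp (Primrec.nat_le.comp (Primrec.nat_sub.comp (primrec_order (hM.comp h0))
    (Primrec.const 1)) Primrec.snd) (Primrec.eq.comp (primrec_entry (hw.comp h0) Primrec.snd)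
      (Primrec.snd.comp Primrec.fst))

theorem primrecPred_tours (hM : Primrec M) (hT : Primrec T) (hw : Primrec w) :
    PrimrecPred fun a => Tours (M a) (T a) (w a) := by
  refine primrecPred_forall_lt (primrec_order hM)
    (primrecPred_imp (primrecPred_inOrbit (hM.comp Primrec.fst) Primrec.snd) ?_)
  refine primrecPred_exists_lt (Primrec.succ.comp (hT.comp Primrec.fst)) ?_
  have h0 : Primrec fun q : (α × ℕ) × ℕ => q.1.1 := Primrec.fst.comp Primrec.fst
  exact (Primrec.nat_le.comp (Primrec.nat_sub.comp (primrec_order (hM.comp h0))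
    (Primrec.const 1)) Primrec.snd).and (Primrec.eq.comp (primrec_entry (hw.comp h0) Primrec.snd)
      (Primrec.snd.comp Primrec.fst))

theorem primrec_parkingWalk : Primrec parkingWalk := by
  have hM : Primrec fun q : (List (List (List Bool)) × ℕ) × List ℕ => q.1.1 :=
    Primrec.fst.comp Primrec.fst
  exact primrec_search (primrec_tuples (primrec_order Primrec.fst)
    (Primrec.list_length.comp Primrec.fst)) ((primrecPred_validWalk hM
      (Primrec.snd.comp Primrec.fst) Primrec.snd).and (primrecPred_parks hM Primrec.snd))

theorem primrec_touringWalk : Primrec touringWalk := by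
  have hM : Primrec fun q : (List (List (List Bool)) × ℕ) × List ℕ => q.1.1 :=
    Primrec.fst.comp Primrec.fst
  have hx : Primrec fun q : (List (List (List Bool)) × ℕ) × List ℕ => q.1.2 :=
    Primrec.snd.comp Primrec.fst
  refine primrec_search (primrec_tuples (primrec_order Primrec.fst)
    (Primrec.list_length.comp Primrec.fst)) ((primrecPred_validWalk hM hx Primrec.snd).and ?_)
  refine primrecPred_exists_lt (Primrec.list_length.comp hM) ?_
  refine (primrecPred_tours (hM.comp Primrec.fst) Primrec.snd
    (Primrec.snd.comp Primrec.fst)).and ?_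
  refine primrecPred_forall_lt Primrec.snd ?_
  have h2 := hM.comp (Primrec.fst.comp (Primrec.fst (α := (_ × ℕ)) (β := ℕ)))
  refine primrecPred_forall_mem (primrec_tuples (primrec_order h2)
    (Primrec.list_length.comp h2)) ?_
  exact primrecPred_imp (primrecPred_validWalk (h2.comp Primrec.fst)
    (hx.comp (Primrec.fst.comp (Primrec.fst.comp Primrec.fst))) Primrec.snd)
    (primrecPred_tours (h2.comp Primrec.fst) (Primrec.snd.comp Primrec.fst) Primrec.snd).not

end Primrec

end Exploration

/-! ### The matrices describe the temporal graph -/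

namespace Exploration

open MulAction TemporalGraph

section Dictionary

variable {n ℓ : ℕ} {H : TemporalGraph (Fin n) ℓ}

theorem getD_ofFn {α : Type*} {k : ℕ} (f : Fin k → α) (i : Fin k) (d : α) :
    (List.ofFn f).getD i d = f i := by
  simp [List.getD_eq_getElem?_getD]

theorem map_range_eq_ofFn {α : Type*} {k : ℕ} {g : ℕ → α} {f : Fin k → α}
    (h : ∀ i : Fin k, g i = f i) : (List.range k).map g = List.ofFn f := by
  rw [List.ofFn_eq_map, ← List.map_coe_finRange_eq_range, List.map_map]
  exact List.map_congr_left fun i _ => h i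

theorem length_matrices : H.matrices.length = ℓ := by simp [matrices]

theorem order_matrices (hℓ : 0 < ℓ) : order H.matrices = n := by
  have h := getD_ofFn (fun t : Fin ℓ => List.ofFn fun i => List.ofFn fun j =>
    @decide ((H.snapshot t).Adj i j) (Classical.propDecidable _)) ⟨0, hℓ⟩ []
  rw [order, matrices, h, List.length_ofFn]

theorem adjEntry_matrices (t : Fin ℓ) (i j : Fin n) :
    adjEntry H.matrices t i j = true ↔ (H.snapshot t).Adj i j := by
  simp [adjEntry, matrices]

theorem permute_matrices (hℓ : 0 < ℓ) (σ : Equiv.Perm (Fin n)) :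
    permute H.matrices (List.ofFn fun i => (σ i : ℕ)) = (H.relabel σ.symm).matrices := by
  rw [permute, order_matrices hℓ, length_matrices]
  refine map_range_eq_ofFn fun t => map_range_eq_ofFn fun i => map_range_eq_ofFn fun j => ?_
  rw [getD_ofFn, getD_ofFn, Bool.eq_iff_iff, adjEntry_matrices]
  exact (@decide_eq_true_iff _ (Classical.propDecidable _)).symm

theorem permute_eq_self_iff (hℓ : 0 < ℓ) (σ : Equiv.Perm (Fin n)) :
    permute H.matrices (List.ofFn fun i => (σ i : ℕ)) = H.matrices ↔ H.IsIso H σ := by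
  rw [permute_matrices hℓ, matrices_injective.eq_iff]
  constructor
  · intro h t x y
    conv_rhs => rw [← h]
    simp [relabel]
  · intro h
    obtain ⟨H⟩ := H
    simp only [relabel]
    congr 1
    ext t x y
    exact h t x y

theorem orbitSize_matrices (hℓ : 0 < ℓ) (x : Fin n) :
    orbitSize H.matrices x = (orbit H.aut x).ncard := by
  have h : ∀ y : ℕ, (∃ w ∈ perms n, permute H.matrices w = H.matrices ∧ w.getD x 0 = y) ↔
      ∃ z ∈ orbit H.aut x, (z : ℕ) = y := by
    intro y
    constructor
    · rintro ⟨w, hw, h1, rfl⟩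
      obtain ⟨σ, rfl⟩ := mem_perms.1 hw
      exact ⟨σ x, ⟨⟨σ, (permute_eq_self_iff hℓ σ).1 h1⟩, rfl⟩,
        (getD_ofFn (fun i => (σ i : ℕ)) x 0).symm⟩
    · rintro ⟨_, ⟨⟨σ, hσ⟩, rfl⟩, rfl⟩
      exact ⟨_, mem_perms.2 ⟨σ, rfl⟩, (permute_eq_self_iff hℓ σ).2 hσ, getD_ofFn _ _ _⟩
  classical
  rw [← Set.ncard_image_of_injective _ Fin.val_injective]
  have h1 : Fin.val '' orbit H.aut x = (((List.range n).filter fun y =>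
      decide (∃ w ∈ perms n, permute H.matrices w = H.matrices ∧ w.getD x 0 = y)).toFinset :
        Set ℕ) := by
    ext y
    simp only [List.coe_toFinset, List.mem_filter, List.mem_range, decide_eq_true_eq, h,
      Set.mem_image, Set.mem_ofPred_eq, iff_and_self]
    rintro ⟨z, -, rfl⟩
    exact z.2
  rw [h1, Set.ncard_coe_finset, List.toFinset_card_of_nodup (List.nodup_range.filter _), orbitSize,
    order_matrices hℓ]

theorem small_matrices (hℓ : 0 < ℓ) (x : Fin n) : Small H.matrices x ↔ H.IsSmall x := by
  rw [Small, order_matrices hℓ, orbitSize_matrices hℓ]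
  exact ⟨fun h y => orbitSize_matrices hℓ y ▸ h y y.2,
    fun h y hy => orbitSize_matrices hℓ ⟨y, hy⟩ ▸ h ⟨y, hy⟩⟩

theorem inOrbit_matrices (hℓ : 0 < ℓ) (x : Fin n) :
    InOrbit H.matrices x ↔ x ∈ H.leastOrbit := by
  have hcode : ∀ (σ : Equiv.Perm (Fin n)) (i : Fin n), Encodable.encode
      (permute H.matrices (List.ofFn fun i => (σ i : ℕ)), (i : ℕ)) = H.code σ.symm (σ i) := by
    intro σ i
    rw [permute_matrices hℓ, code, Equiv.symm_apply_apply]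
  rw [InOrbit, order_matrices hℓ, small_matrices hℓ]
  refine and_congr_right fun hx => ?_
  constructor
  · rintro ⟨w, hw, i, hi, hwi, h⟩
    obtain ⟨σ, rfl⟩ := mem_perms.1 hw
    lift i to Fin n using hi
    rw [getD_ofFn] at hwi
    obtain rfl := Fin.ext hwi
    refine ⟨n, σ.symm, fun m lab' y hy => ?_⟩
    obtain rfl : n = m := by simpa using Fintype.card_congr lab'
    have h1 := h _ (mem_perms.2 ⟨lab'.symm, rfl⟩) (lab' y) (lab' y).2
    rw [getD_ofFn, hcode, hcode, Equiv.symm_symm, Equiv.symm_apply_apply,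
      small_matrices hℓ] at h1
    exact h1 hy
  · rintro ⟨m, lab, h⟩
    obtain rfl : n = m := by simpa using Fintype.card_congr lab
    refine ⟨_, mem_perms.2 ⟨lab.symm, rfl⟩, lab x, (lab x).2, by simp, ?_⟩
    intro w hw j hj
    obtain ⟨σ, rfl⟩ := mem_perms.1 hw
    lift j to Fin n using hj
    rw [getD_ofFn, hcode, hcode, Equiv.symm_symm, Equiv.symm_apply_apply, small_matrices hℓ]
    exact h _ _ _

theorem validWalk_matrices (hℓ : 0 < ℓ) (x : Fin n) (f : Fin ℓ → Fin n) :
    ValidWalk H.matrices x (List.ofFn fun t => (f t : ℕ)) ↔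
      ∃ W : TemporalWalk H, W.pos = f ∧ W.StartsAt x := by
  have hstep : ∀ s t : Fin ℓ, (t : ℕ) = s + 1 →
      (((List.ofFn fun t => (f t : ℕ)).getD (s + 1) 0 = (List.ofFn fun t => (f t : ℕ)).getD s 0 ∨
      adjEntry H.matrices s ((List.ofFn fun t => (f t : ℕ)).getD s 0)
        ((List.ofFn fun t => (f t : ℕ)).getD (s + 1) 0) = true) ↔
      (f t = f s ∨ (H.snapshot s).Adj (f s) (f t))) := by
    intro s t hst
    rw [← hst, getD_ofFn, getD_ofFn, adjEntry_matrices, Fin.val_inj]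
  rw [ValidWalk, length_matrices]
  constructor
  · rintro ⟨h1, h2⟩
    refine ⟨⟨f, fun s t hst => (hstep s t hst).1 (h1 s (by omega))⟩, rfl, fun t ht => ?_⟩
    rw [← ht, getD_ofFn] at h2
    exact Fin.ext h2
  · rintro ⟨W, rfl, hW⟩
    refine ⟨fun s hs => (hstep ⟨s, by omega⟩ ⟨s + 1, by omega⟩ rfl).2 (W.step _ _ rfl), ?_⟩
    rw [← hW ⟨0, hℓ⟩ rfl]
    exact getD_ofFn (fun t => (W.pos t : ℕ)) ⟨0, hℓ⟩ 0

theorem parks_matrices (hℓ : 0 < ℓ) (f : Fin ℓ → Fin n) :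
    Parks H.matrices (List.ofFn fun t => (f t : ℕ)) ↔
      ∃ y ∈ H.leastOrbit, ∀ t : Fin ℓ, n - 1 ≤ t → f t = y := by
  rw [Parks, order_matrices hℓ, length_matrices]
  constructor
  · rintro ⟨y, hy, hyS, h⟩
    lift y to Fin n using hy
    refine ⟨y, (inOrbit_matrices hℓ y).1 hyS, fun t ht => Fin.ext ?_⟩
    rw [← h t t.2 ht, getD_ofFn]
  · rintro ⟨y, hyS, h⟩
    refine ⟨y, y.2, (inOrbit_matrices hℓ y).2 hyS, fun t ht htn => ?_⟩
    lift t to Fin ℓ using ht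
    rw [getD_ofFn, h t htn]

theorem tours_matrices {T : ℕ} (hT : T < ℓ) (f : Fin ℓ → Fin n) :
    Tours H.matrices T (List.ofFn fun t => (f t : ℕ)) ↔
      ∀ y ∈ H.leastOrbit, ∃ t : Fin ℓ, n - 1 ≤ t ∧ (t : ℕ) ≤ T ∧ f t = y := by
  have hℓ : 0 < ℓ := by omega
  rw [Tours, order_matrices hℓ]
  constructor
  · intro h y hy
    obtain ⟨t, h1, h2, h3⟩ := h y y.2 ((inOrbit_matrices hℓ y).2 hy)
    lift t to Fin ℓ using (by omega)
    rw [getD_ofFn] at h3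
    exact ⟨t, h2, by omega, Fin.ext h3⟩
  · intro h y hy hyS
    lift y to Fin n using hy
    obtain ⟨t, h1, h2, h3⟩ := h y ((inOrbit_matrices hℓ y).1 hyS)
    exact ⟨t, by omega, h1, by rw [getD_ofFn, h3]⟩

end Dictionary

/-! ### The two agents -/

section Agents

variable {V : Type u} {ℓ : ℕ}

/-- A temporal graph continued for ever by complete graphs, which admit all permutations as
automorphisms. -/
noncomputable def extend (G : TemporalGraph V ℓ) (t : ℕ) : SimpleGraph V :=
  if h : t < ℓ then G.snapshot ⟨t, h⟩ else ⊤

theorem connected_extend [Nonempty V] {G : TemporalGraph V ℓ} (hG : G.Connected) (t : ℕ) :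
    (extend G t).Connected := by
  unfold extend
  split
  · exact hG _
  · exact SimpleGraph.connected_top

theorem preserves_extend (G : TemporalGraph V ℓ) : Preserves G.aut (extend G) := by
  rintro ⟨σ, hσ⟩ t x y h
  by_cases ht : t < ℓ
  · rw [extend, dif_pos ht] at h ⊢
    exact (hσ _ x y).2 h
  · rw [extend, dif_neg ht] at h ⊢
    simpa [Subgroup.smul_def] using h

/-- The restriction of an infinite walk to the lifetime. -/
def truncate {G : TemporalGraph V ℓ} {f : ℕ → V} (hf : IsWalk (extend G) f) :
    TemporalWalk G where
  pos t := f t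
  step s t hst := by
    have h := hf s
    rw [extend, dif_pos s.2] at h
    rw [hst]
    exact h

/-- A walk in the labelled graph, performed in the graph itself. -/
def unlabel {G : TemporalGraph V ℓ} {n : ℕ} (lab : V ≃ Fin n) (W : TemporalWalk (G.relabel lab)) :
    TemporalWalk G where
  pos t := lab.symm (W.pos t)
  step s t hst := (W.step s t hst).imp (congrArg lab.symm) id

theorem connected_relabel {G : TemporalGraph V ℓ} (hG : G.Connected) {n : ℕ} (lab : V ≃ Fin n) :
    (G.relabel lab).Connected :=
  fun t => (SimpleGraph.Iso.connected_iff (SimpleGraph.Iso.comap lab.symm (G.snapshot t))).2 (hG t)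

variable {n : ℕ} {H : TemporalGraph (Fin n) ℓ}

theorem exists_parkingWalk (hℓ : n ^ 2 ≤ ℓ) (hH : H.Connected) (x : Fin n) :
    ∃ W : TemporalWalk H, W.StartsAt x ∧
      parkingWalk (H.matrices, (x : ℕ)) = List.ofFn (fun t => (W.pos t : ℕ)) ∧
      ∃ y ∈ H.leastOrbit, ∀ t : Fin ℓ, n - 1 ≤ t → W.pos t = y := by
  have hn : 0 < n := x.pos
  have hℓ0 : 0 < ℓ := lt_of_lt_of_le (by positivity) hℓ
  have : Nonempty (Fin n) := ⟨x⟩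
  obtain ⟨y, hy⟩ := H.exists_mem_leastOrbit
  obtain ⟨f, hf, h0, h1⟩ := mem_reach_of_card_le (connected_extend hH) 0 x y (d := n - 1)
    (by rw [Nat.card_eq_fintype_card, Fintype.card_fin]; omega)
  obtain ⟨p, hp, e1, e2⟩ := hf.exists_concat (isWalk_const y) (t := n - 1) (by rw [← h1, zero_add])
  obtain ⟨hmem, hvalid, hparks⟩ : parkingWalk (H.matrices, (x : ℕ)) ∈
      tuples (order H.matrices) H.matrices.length ∧
      ValidWalk H.matrices x (parkingWalk (H.matrices, (x : ℕ))) ∧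
      Parks H.matrices (parkingWalk (H.matrices, (x : ℕ))) := search_spec
    ⟨List.ofFn fun t : Fin ℓ => (p t : ℕ), by
      rw [order_matrices hℓ0, length_matrices]
      exact mem_tuples.2 ⟨fun t => p t, rfl⟩,
      (validWalk_matrices hℓ0 x fun t => p t).2 ⟨truncate hp, rfl, fun t ht => by
        simp only [truncate]; rw [ht, e1 _ (by omega), h0]⟩,
      (parks_matrices hℓ0 fun t => p t).2 ⟨y, hy, fun t ht => e2 _ ht⟩⟩
  rw [order_matrices hℓ0, length_matrices] at hmem
  obtain ⟨g, hg⟩ := mem_tuples.1 hmem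
  rw [hg] at hvalid hparks
  obtain ⟨W, rfl, hW⟩ := (validWalk_matrices hℓ0 x g).1 hvalid
  exact ⟨W, hW, hg, (parks_matrices hℓ0 _).1 hparks⟩

/-- The earliest possible tour is no later than the fast tour, if that one ends within the
lifetime, and no later than the slow tour otherwise. -/
theorem exists_touringWalk {ε : ℝ} (hε : 0 < ε) : ∃ C : ℝ, ∀ {n ℓ : ℕ}
    {H : TemporalGraph (Fin n) ℓ}, n ^ 2 ≤ ℓ → H.Connected → ∀ x : Fin n,
    ∃ W : TemporalWalk H, W.StartsAt x ∧
      touringWalk (H.matrices, (x : ℕ)) = List.ofFn (fun t => (W.pos t : ℕ)) ∧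
      ∃ T : ℕ, (T : ℝ) + 1 ≤ C * (n : ℝ) ^ (1 + ε) ∧
        ∀ y ∈ H.leastOrbit, ∃ t : Fin ℓ, n - 1 ≤ t ∧ (t : ℕ) ≤ T ∧ W.pos t = y := by
  classical
  obtain ⟨C, hC⟩ := exists_fast_tour.{0} hε
  refine ⟨C, fun {n ℓ H} hℓ hH x => ?_⟩
  have hn : 0 < n := x.pos
  have hℓ0 : 0 < ℓ := lt_of_lt_of_le (by positivity) hℓ
  have : Nonempty (Fin n) := ⟨x⟩
  obtain ⟨v₀, hv₀⟩ := H.exists_mem_leastOrbit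
  have hS := leastOrbit_eq_orbit hv₀
  let Q : ℕ → Prop := fun T => T < ℓ ∧ ∃ w ∈ tuples n ℓ,
    ValidWalk H.matrices x w ∧ Tours H.matrices T w
  have hQ : ∀ {f : ℕ → Fin n}, IsWalk (extend H) f → f 0 = x → ∀ T < ℓ,
      (∀ y ∈ H.leastOrbit, ∃ t, n - 1 ≤ t ∧ t ≤ T ∧ f t = y) → Q T := by
    intro f hf h0 T hT h
    refine ⟨hT, _, mem_tuples.2 ⟨fun t => f t, rfl⟩, (validWalk_matrices hℓ0 x fun t => f t).2
      ⟨truncate hf, rfl, fun t ht => by simp only [truncate]; rw [ht, h0]⟩,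
      (tours_matrices hT fun t => f t).2 fun y hy => ?_⟩
    obtain ⟨t, h1, h2, h3⟩ := h y hy
    exact ⟨⟨t, by omega⟩, h1, h2, h3⟩
  obtain ⟨T₁, hT₁C, hT₁⟩ : ∃ T : ℕ, (T : ℝ) + 1 ≤ C * (n : ℝ) ^ (1 + ε) ∧ Q T := by
    obtain ⟨f, hf, h0, T, hT, h⟩ := hC (Fin n) H.aut (extend H) v₀ x (connected_extend hH)
      (preserves_extend H) hv₀.1
    rw [Fintype.card_fin] at hT h
    by_cases hTℓ : T < ℓ
    · exact ⟨T, hT, hQ hf h0 T hTℓ (hS ▸ h)⟩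
    · obtain ⟨f, hf, h0, h⟩ := exists_slow_tour (connected_extend hH) x Finset.univ
      rw [Finset.card_univ, Fintype.card_fin] at h
      have h1 : n * (n - 1) < ℓ := by
        refine lt_of_lt_of_le ?_ hℓ
        rw [sq]
        exact Nat.mul_lt_mul_of_pos_left (by omega) hn
      refine ⟨n * (n - 1), le_trans ?_ hT, hQ hf h0 _ h1 fun y _ => h y (Finset.mem_univ y)⟩
      have h2 : n * (n - 1) ≤ T := by omega
      gcongr
  have hex : ∃ T, Q T := ⟨_, hT₁⟩
  obtain ⟨hT, w, hw, hw1, hw2⟩ := Nat.find_spec hex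
  obtain ⟨hmem, hvalid, T, hTℓ, htours, hmin⟩ : touringWalk (H.matrices, (x : ℕ)) ∈
      tuples (order H.matrices) H.matrices.length ∧
      ValidWalk H.matrices x (touringWalk (H.matrices, (x : ℕ))) ∧ ∃ T < H.matrices.length,
        Tours H.matrices T (touringWalk (H.matrices, (x : ℕ))) ∧
        ∀ T' < T, ∀ w' ∈ tuples (order H.matrices) H.matrices.length,
          ValidWalk H.matrices x w' → ¬ Tours H.matrices T' w' := search_spec
    (by
      rw [order_matrices hℓ0, length_matrices]
      exact ⟨w, hw, hw1, _, hT, hw2, fun T' hT' w' hw' h1 h2 =>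
        Nat.find_min hex hT' ⟨hT'.trans hT, w', hw', h1, h2⟩⟩)
  rw [order_matrices hℓ0, length_matrices] at hmem
  obtain ⟨g, hg⟩ := mem_tuples.1 hmem
  rw [hg] at hvalid htours
  rw [order_matrices hℓ0, length_matrices] at hmin
  rw [length_matrices] at hTℓ
  obtain ⟨W, rfl, hW⟩ := (validWalk_matrices hℓ0 x g).1 hvalid
  refine ⟨W, hW, hg, T, le_trans ?_ hT₁C, (tours_matrices hTℓ _).1 htours⟩
  obtain ⟨-, w₁, h1, h2, h3⟩ := hT₁
  have h4 : T ≤ T₁ := not_lt.1 fun h => hmin T₁ h w₁ h1 h2 h3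
  gcongr

theorem ncard_leastOrbit_le [Finite V] [Nonempty V] (G : TemporalGraph V ℓ) :
    (G.leastOrbit.ncard : ℝ) ≤ (Nat.card V : ℝ) / (G.orbitNumber : ℝ) := by
  classical
  have := Fintype.ofFinite V
  obtain ⟨x, hx⟩ := G.exists_mem_leastOrbit
  have h := ncard_range_orbit_mul_le (Γ := G.aut) (S := G.leastOrbit.toFinset) fun y => by
    rw [← Set.ncard_eq_toFinset_card', leastOrbit_eq_orbit hx]
    exact hx.1 y
  rw [← Set.ncard_eq_toFinset_card', ← Nat.card_eq_fintype_card] at h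
  have h0 : 0 < G.orbitNumber := (Set.ncard_pos (Set.toFinite _)).2 ⟨_, x, rfl⟩
  rw [le_div_iff₀ (by exact_mod_cast h0), mul_comm]
  exact_mod_cast h

end Agents

end Exploration

theorem mainTheorem2 (ε : ℝ) (hε : 0 < ε) :
    ∃ (p₁ p₂ : Program) (S : ∀ (V : Type u) (ℓ : ℕ), TemporalGraph V ℓ → Set V) (C : ℝ),
      IsCanonicalSmallestOrbit S ∧
      ∀ (n ℓ : ℕ) (_ : n ^ 2 ≤ ℓ) (V : Type u) (G : TemporalGraph V ℓ) (_ : G.Connected)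
        (lab₁ lab₂ : V ≃ Fin n) (x₁ x₂ : V),
        ((S V ℓ G).ncard : ℝ) ≤ (n : ℝ) / (G.orbitNumber : ℝ) ∧
        ∃ W₁ W₂ : TemporalWalk G,
          p₁.Performs G lab₁ x₁ W₁ ∧ p₂.Performs G lab₂ x₂ W₂ ∧
          (∃ t : Fin ℓ, W₁.pos t = W₂.pos t ∧ W₁.pos t ∈ S V ℓ G ∧
            (t : ℝ) + 1 ≤ C * (n : ℝ) ^ (1 + ε)) ∧
          (∀ y ∈ S V ℓ G, ∃ t : Fin ℓ, W₂.pos t = y ∧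
            (t : ℝ) + 1 ≤ C * (n : ℝ) ^ (1 + ε)) := by
  obtain ⟨C, hC⟩ := Exploration.exists_touringWalk hε
  refine ⟨⟨Exploration.parkingWalk, Exploration.primrec_parkingWalk.to_comp⟩,
    ⟨Exploration.touringWalk, Exploration.primrec_touringWalk.to_comp⟩,
    fun _ _ G => G.leastOrbit, C, TemporalGraph.isCanonicalSmallestOrbit_leastOrbit, ?_⟩
  intro n ℓ hℓ V G hG lab₁ lab₂ x₁ x₂
  have : Finite V := Finite.of_equiv _ lab₁.symm
  have : Nonempty V := ⟨x₁⟩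
  have hcard : Nat.card V = n := by rw [Nat.card_congr lab₁, Nat.card_fin]
  obtain ⟨W₁, hs₁, hr₁, y₁, hy₁, hp₁⟩ :=
    Exploration.exists_parkingWalk hℓ (Exploration.connected_relabel hG lab₁) (lab₁ x₁)
  obtain ⟨W₂, hs₂, hr₂, T, hT, hp₂⟩ := hC hℓ (Exploration.connected_relabel hG lab₂) (lab₂ x₂)
  have hvisit : ∀ y ∈ G.leastOrbit, ∃ t : Fin ℓ, n - 1 ≤ t ∧
      (Exploration.unlabel lab₂ W₂).pos t = y ∧ (t : ℝ) + 1 ≤ C * (n : ℝ) ^ (1 + ε) := by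
    intro y hy
    obtain ⟨t, h1, h2, h3⟩ := hp₂ _ ((TemporalGraph.isIso_relabel G lab₂).mem_leastOrbit hy)
    refine ⟨t, h1, by simp [Exploration.unlabel, h3], le_trans ?_ hT⟩
    gcongr
  have hy₁' := (TemporalGraph.isIso_relabel G lab₁).symm.mem_leastOrbit hy₁
  refine ⟨hcard ▸ Exploration.ncard_leastOrbit_le G,
    Exploration.unlabel lab₁ W₁, Exploration.unlabel lab₂ W₂,
    ⟨fun t ht => by simp [Exploration.unlabel, hs₁ t ht],
      hr₁.trans (by simp [Exploration.unlabel])⟩,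
    ⟨fun t ht => by simp [Exploration.unlabel, hs₂ t ht],
      hr₂.trans (by simp [Exploration.unlabel])⟩, ?_, ?_⟩
  -- agent 1 is at `y₁` from time `n - 1` on, when agent 2 comes by
  · obtain ⟨t, h1, h2, h3⟩ := hvisit _ hy₁'
    have h4 : (Exploration.unlabel lab₁ W₁).pos t = lab₁.symm y₁ := by
      simp [Exploration.unlabel, hp₁ t h1]
    exact ⟨t, by rw [h2, h4], by rw [h4]; exact hy₁', h3⟩
  · intro y hy
    obtain ⟨t, -, h2, h3⟩ := hvisit y hy
    exact ⟨t, h2, h3⟩
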